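/- Let $(\mathcal A,\varphi,\varphi')$ be an infinitesimal noncommutative probability space: $\mathcal A$ is a unital complex algebra and $\varphi,\varphi':\mathcal A\to\mathbb C$ are linear with $\varphi(1)=1$, $\varphi'(1)=0$. Its non-crossing cumulants and infinitesimal non-crossing cumulants are, for $n\ge 1$, $$\kappa_n(a_1,\dots,a_n)=\sum_{\pi\in NC(n)}\text{Möb}(\pi,1_n)\prod_{V\in\pi}\varphi_V(a_1,\dots,a_n),$$ $$\kappa_n'(a_1,\dots,a_n)=\sum_{\pi\in NC(n)}\sum_{V\in\pi}\text{Möb}(\pi,1_n)\,\varphi'_V(a_1,\dots,a_n)\prod_{W\in\pi,\,W\ne V}\varphi_W(a_1,\dots,a_n),$$ where $NC(n)$ is the lattice of non-crossing partitions of $\{1,\dots,n\}$ ordered by reverse refinement, $\text{Möb}$ is its Möbius function, $1_n$ is the one-block partition, and $f_V(a_1,\dots,a_n)=f(a_{v_1}\cdots a_{v_m})$ for $V=\{v_1<\dots<v_m\}$. Let $\mathbb G=\{a+\varepsilon b: a,b\in\mathbb C\}$ with $\varepsilon^2=0$ (body $a$, soul $b$), put $\widetilde\varphi=\varphi+\varepsilon\varphi':\mathcal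 A\to\mathbb G$, and let $\widetilde\kappa_n:\mathcal A^n\to\mathbb G$ be defined from $\widetilde\varphi$ by the formula which defines $\kappa_n$ from $\varphi$. Unital subalgebras $(\mathcal A_i)_{i\in I}$ are infinitesimally free if for all $n\ge1$, all $i_1\ne i_2,\ i_2\neq i_3,\ \dots,\ i_{n-1}\ne i_n$ in $I$ and all $a_j\in\mathcal A_{i_j}$ with $\varphi(a_j)=0$ for every $j$, one has $\varphi(a_1\cdots a_n)=0$, and $\varphi'(a_1\cdots a_n)=\varphi'(a_{(n+1)/2})\prod_{j=1}^{(n-1)/2}\varphi(a_ja_{n+1-j})$ if $n$ is odd and $i_j=i_{n+1-j}$ for all $j$, while $\varphi'(a_1\cdots a_n)=0$ otherwise. Subsets are infinitesimally free if the unital subalgebras they generate are. **Theorem 5.4.** Let $p\in\mathcal A$ be idempotent with $\alpha:=\varphi(p)\neq0$, and let $\alpha':=\varphi'(p)$ and $\widetilde\alpha:=\alpha+\varepsilon\alpha'$. Let $\mathcal X\subseteq\mathcal A$ be a subset such that $\mathcal X$ and $\{p\}$ are infinitesimally free. Let $\mathcal B=p\mathcal Ap$ (a unital algebra with unit $p$),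 with functionals $\psi(b)=\frac1\alpha\varphi(b)$ and $\psi'(b)=\frac1\alpha\varphi'(b)-\frac{\alpha'}{\alpha^2}\varphi(b)$, and let $\underline\kappa_n,\underline\kappa_n',\underline{\widetilde\kappa}_n$ be the functionals $\kappa_n,\kappa_n',\widetilde\kappa_n$ of the infinitesimal noncommutative probability space $(\mathcal B,\psi,\psi')$. Then for all $n\ge1$ and $x_1,\dots,x_n\in\mathcal X$ $$\underline\kappa_n(px_1p,\dots,px_np)=\frac1\alpha\,\kappa_n(\alpha x_1,\dots,\alpha x_n);$$ moreover $\underline\kappa_1'(px_1p)=\kappa_1'(x_1)$ for all $x_1\in\mathcal X$, and for all $n\ge2$ and $x_1,\dots,x_n\in\mathcal X$ $$\underline\kappa_n'(px_1p,\dots,px_np)=\frac1\alpha\,\kappa_n'(\alpha x_1,\dots,\alpha x_n)+\frac{(n-1)\alpha'}{\alpha^2}\,\kappa_n(\alpha x_1,\dots,\alpha x_n).$$ Furthermore, for all $n\ge1$ and $x_1,\dots,x_n\in\mathcal X$, $$\underline{\widetilde\kappa}_n(px_1p,\dots,px_np)=\widetilde\alpha^{\,n-1}\,\widetilde\kappa_n(x_1,\dots,x_n),$$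 and the left-hand side has body $\underline\kappa_n(px_1p,\dots,px_np)$ and soul $\underline\kappa_n'(px_1p,\dots,px_np)$, so the formulas above are the body and soul parts of this one. -/

import Mathlib

namespace InfFree

/-! ### Non-crossing partitions and their Möbius function -/

/-- A partition of `Fin n` is non-crossing if there are no `i < j < k < l` with `i, k` in one block
and `j, l` in a different one. -/
def IsNonCrossing {n : ℕ} (π : Finpartition (Finset.univ : Finset (Fin n))) : Prop :=
  ∀ V ∈ π.parts, ∀ W ∈ π.parts, ∀ i j k l : Fin n,
    i < j → j < k → k < l → i ∈ V → k ∈ V → j ∈ W → l ∈ W → V = W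

/-- `NC(n)`, with the order of reverse refinement inherited from `Finpartition`: `π ≤ ρ` iff every
block of `π` is contained in a block of `ρ`. -/
abbrev NC (n : ℕ) : Type :=
  {π : Finpartition (Finset.univ : Finset (Fin n)) // IsNonCrossing π}

/-- The partition `1_n` of `Fin n` with a single block (for `n ≥ 1`). -/
def NC.one (n : ℕ) : NC n :=
  ⟨⊤, fun _ hV _ hW _ _ _ _ _ _ _ _ _ _ _ =>
    Finpartition.parts_top_subsingleton _ (Finset.mem_coe.2 hV) (Finset.mem_coe.2 hW)⟩

noncomputable instance (n : ℕ) : Fintype (NC n) := Fintype.ofFinite _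

open Classical in
noncomputable instance (n : ℕ) : LocallyFiniteOrder (NC n) := Fintype.toLocallyFiniteOrder

open Classical in
/-- The value `Möb(π, 1_n)` of the Möbius function of the lattice `NC(n)`. -/
noncomputable def NC.moeb {n : ℕ} (π : NC n) : ℤ := IncidenceAlgebra.mu ℤ π (NC.one n)

/-! ### Moments and non-crossing cumulants -/

section Cumulants

variable {A R : Type*} [Ring A] [Algebra ℂ A] [CommRing R] [Algebra ℂ R]

/-- The moment functional `f_m(a_1, …, a_m) = f(a_1 ⋯ a_m)`. -/
def moment (f : A →ₗ[ℂ] R) {m : ℕ} (a : Fin m → A) : R := f (List.ofFn a).prod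

/-- The restriction `(a_1, …, a_n) | V = (a_{v_1}, …, a_{v_m})`, where `v_1 < ⋯ < v_m` are the
elements of `V`. -/
def restr {n : ℕ} (a : Fin n → A) (V : Finset (Fin n)) : Fin V.card → A :=
  fun i => a (V.orderEmbOfFin rfl i)

/-- The `n`-th non-crossing cumulant functional of `f`:
`∑_{π ∈ NC(n)} Möb(π, 1_n) ∏_{V ∈ π} f_{|V|}((a_1, …, a_n) | V)`. It is used for complex-valued
functionals and for functionals with values in the Grassmann algebra `ℂ[ε]`, `ε² = 0`. -/
noncomputable def cumulant (f : A →ₗ[ℂ] R) (n : ℕ) (a : Fin n → A) : R :=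
  ∑ π : NC n, (π.moeb : R) * ∏ V ∈ π.1.parts, moment f (restr a V)

end Cumulants

/-! ### Infinitesimal noncommutative probability spaces -/

/-- The data `(φ, φ')` making a unital complex algebra `A` an infinitesimal noncommutative
probability space: linear functionals with `φ(1) = 1` and `φ'(1) = 0`. -/
structure Incps (A : Type*) [Ring A] [Algebra ℂ A] where
  /-- the functional `φ` -/
  φ : A →ₗ[ℂ] ℂ
  /-- the functional `φ'` -/
  φ' : A →ₗ[ℂ] ℂ
  φ_one : φ 1 = 1
  φ'_one : φ' 1 = 0

namespace Incps

variable {A : Type*} [Ring A] [Algebra ℂ A] (P : Incps A)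

/-- The consolidated functional `φ̃ = φ + ε φ'` with values in the Grassmann algebra `ℂ[ε]`. -/
noncomputable def consolidated : A →ₗ[ℂ] DualNumber ℂ :=
  (TrivSqZeroExt.inlAlgHom ℂ ℂ ℂ).toLinearMap ∘ₗ P.φ + (TrivSqZeroExt.inrHom ℂ ℂ) ∘ₗ P.φ'

/-- The non-crossing cumulant functional `κ_n`. -/
noncomputable def κ (n : ℕ) (a : Fin n → A) : ℂ := cumulant P.φ n a

open Classical in
/-- The infinitesimal non-crossing cumulant functional `κ'_n`:
`∑_{π ∈ NC(n)} ∑_{V ∈ π} Möb(π, 1_n) φ'_{|V|}(a | V) ∏_{W ∈ π, W ≠ V} φ_{|W|}(a | W)`. -/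
noncomputable def κ' (n : ℕ) (a : Fin n → A) : ℂ :=
  ∑ π : NC n, ∑ V ∈ π.1.parts,
    (π.moeb : ℂ) * moment P.φ' (restr a V) * ∏ W ∈ π.1.parts.erase V, moment P.φ (restr a W)

/-- The `ℂ[ε]`-valued cumulant functional `κ̃_n`, i.e. the cumulant functional of `φ̃`. -/
noncomputable def κtilde (n : ℕ) (a : Fin n → A) : DualNumber ℂ := cumulant P.consolidated n a

/-- Infinitesimal freeness of a family of unital subalgebras. With 0-based positions, position `j`
is opposite to position `j.rev = n - 1 - j` and, for odd `n`, the middle position is `n / 2`. -/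
def FreeSubalgebras {ι : Type*} (S : ι → Subalgebra ℂ A) : Prop :=
  ∀ (n : ℕ) (hn : 0 < n) (i : Fin n → ι) (a : Fin n → A),
    (∀ (j : ℕ) (hj : j + 1 < n), i ⟨j, Nat.lt_of_succ_lt hj⟩ ≠ i ⟨j + 1, hj⟩) →
    (∀ j, a j ∈ S (i j)) → (∀ j, P.φ (a j) = 0) →
      P.φ (List.ofFn a).prod = 0 ∧
      ((Odd n ∧ ∀ j, i j = i j.rev) →
        P.φ' (List.ofFn a).prod =
          (∏ j ∈ Finset.univ.filter (fun j : Fin n => (j : ℕ) < n / 2), P.φ (a j * a j.rev)) *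
            P.φ' (a ⟨n / 2, Nat.div_lt_self hn one_lt_two⟩)) ∧
      (¬(Odd n ∧ ∀ j, i j = i j.rev) → P.φ' (List.ofFn a).prod = 0)

/-- Infinitesimal freeness of a family of subsets: that of the unital subalgebras they generate. -/
def FreeSets {ι : Type*} (X : ι → Set A) : Prop :=
  P.FreeSubalgebras fun i => Algebra.adjoin ℂ (X i)

end Incps

/-! ### Compression by an idempotent -/

section Compression

variable {A : Type*} [Ring A] [Algebra ℂ A] {p : A} (hp : IsIdempotentElem p)

/-- Scalar multiplication on the corner ring `pAp`, which has unit `p`. -/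
instance : SMul ℂ hp.Corner where
  smul c b := ⟨c • b.1, by
    obtain ⟨r, hr⟩ := b.2
    exact ⟨c • r, by rw [← hr]; simp⟩⟩

instance : Module ℂ hp.Corner where
  one_smul b := Subtype.ext (one_smul ℂ b.1)
  mul_smul c d b := Subtype.ext (mul_smul c d b.1)
  smul_zero c := Subtype.ext (smul_zero c)
  smul_add c b b' := Subtype.ext (smul_add c b.1 b'.1)
  add_smul c d b := Subtype.ext (add_smul c d b.1)
  zero_smul b := Subtype.ext (zero_smul ℂ b.1)

instance : Algebra ℂ hp.Corner := Algebra.ofModule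
  (fun c b b' => Subtype.ext (smul_mul_assoc c b.1 b'.1))
  (fun c b b' => Subtype.ext (mul_smul_comm c b.1 b'.1))

/-- The inclusion `pAp → A`. -/
def cornerIncl : hp.Corner →ₗ[ℂ] A where
  toFun b := b.1
  map_add' _ _ := rfl
  map_smul' _ _ := rfl

/-- The element `p x p` of `pAp`. -/
def compress (x : A) : hp.Corner := ⟨p * x * p, x, rfl⟩

/-- The compression `(pAp, ψ, ψ')` of `(A, φ, φ')`, where, with `α = φ(p) ≠ 0` and `α' = φ'(p)`,
`ψ(b) = φ(b) / α` and `ψ'(b) = φ'(b) / α - (α' / α²) φ(b)`. -/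
noncomputable def Incps.compression (P : Incps A) (hα : P.φ p ≠ 0) : Incps hp.Corner where
  φ := (1 / P.φ p) • (P.φ ∘ₗ cornerIncl hp)
  φ' := (1 / P.φ p) • (P.φ' ∘ₗ cornerIncl hp) -
    (P.φ' p / (P.φ p) ^ 2) • (P.φ ∘ₗ cornerIncl hp)
  φ_one := by
    have h : cornerIncl hp 1 = p := rfl
    simp [h, hα]
  φ'_one := by
    have h : cornerIncl hp 1 = p := rfl
    simp only [LinearMap.sub_apply, LinearMap.smul_apply, LinearMap.comp_apply, h, smul_eq_mul]
    field_simp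
    ring

end Compression

end InfFree

open InfFree

/-! The soul of a statement over `ℂ[ε]` is its formal derivative, so the theorem reduces to free
compression over a commutative ring, applied with scalars `ℂ[ε]`.

Extend `φ̃` to the `ℂ[ε]`-linear functional `F` on `A[ε]`, with `F(a + εb) = φ(a) + ε(φ'(a) +
φ(b))`. Infinitesimal freeness says that on alternating centred products `φ'` obeys a Leibniz rule
`φ'(a₁⋯aₙ) = ∑ⱼ φ'(aⱼ) φ(a₁⋯aⱼ₋₁aⱼ₊₁⋯aₙ)`, in which only the middle term can survive
(`Incps.FreeSubalgebras.φ'_eq_omitSum`). This is exactly the soul of ordinary freeness for `F`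
(`Incps.FreeSets.dualFunctional_prod`). Moreover `ψ̃ = φ̃/α̃`, where `α̃` is a unit because its body
is nonzero.

Over a commutative ring `R`, free cumulants `k` are characterized by expanding a moment over the
block of the last letter, each gap of that block contributing a moment (`IsGapCumulant`). Möbius
inversion identifies them with `cumulant` (`cumulant_eq_of_isGapCumulant`). A Fock-type model
realizes this expansion by operators: a letter either enters the current gap or closes it and joins
the block, while `p` only multiplies the gap. An element of the algebra need not determine an
operator, so elements are carried together with their operators in a product algebra.

Freeness makes the model compute `F` also on words containing `p` (`map_mul_eq_readout`): such a
word is a combination of words in the letters, where the claim is the cumulant recursion, and of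
alternating products, where both sides vanish. In `p x₁ p ⋯ p xₙ p` every gap is itself a compressed
word and contributes `F(p)` times a compressed moment. A block of `n` letters has `n - 1` gaps,
whence the factor `F(p) ^ (n - 1)` (`isGapCumulant_compressedWord`). Body and soul of `α̃ ^ (n - 1)
κ̃ₙ`, with the homogeneity of cumulants, give the remaining formulas. -/

namespace InfFree

/-! ### Sums over non-crossing partitions of finite linearly ordered sets. -/

section NonCrossingSums

variable {ι R : Type*} [LinearOrder ι] [CommRing R]

/-- `B` crosses `C` if there are `i < j < k < l` with `i, k ∈ B` and `j, l ∈ C`. -/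
def Crosses (B C : Finset ι) : Prop :=
  ∃ i j k l, i < j ∧ j < k ∧ k < l ∧ i ∈ B ∧ k ∈ B ∧ j ∈ C ∧ l ∈ C

/-- `σ` is a non-crossing partition of `S` all of whose blocks satisfy `E`. -/
structure IsNCPartition (E : Finset ι → Prop) (S : Finset ι) (σ : Finset (Finset ι)) : Prop where
  nonempty : ∀ B ∈ σ, B.Nonempty
  block : ∀ B ∈ σ, E B
  disj : ∀ B ∈ σ, ∀ C ∈ σ, ∀ i, i ∈ B → i ∈ C → B = C
  mem_iff : ∀ i, i ∈ S ↔ ∃ B ∈ σ, i ∈ B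
  nc : ∀ B ∈ σ, ∀ C ∈ σ, Crosses B C → B = C

theorem IsNCPartition.subset {E : Finset ι → Prop} {S : Finset ι} {σ : Finset (Finset ι)}
    (h : IsNCPartition E S σ) {B : Finset ι} (hB : B ∈ σ) : B ⊆ S :=
  fun i hi => (h.mem_iff i).2 ⟨B, hB, hi⟩

open Classical in
/-- The finset of non-crossing partitions of `S` all of whose blocks satisfy `E`. -/
noncomputable def ncPartitions (E : Finset ι → Prop) (S : Finset ι) : Finset (Finset (Finset ι)) :=
  S.powerset.powerset.filter (IsNCPartition E S)

theorem mem_ncPartitions {E : Finset ι → Prop} {S : Finset ι} {σ : Finset (Finset ι)} :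
    σ ∈ ncPartitions E S ↔ IsNCPartition E S σ := by
  classical
  simp only [ncPartitions, Finset.mem_filter, Finset.mem_powerset, and_iff_right_iff_imp]
  exact fun h B hB => Finset.mem_powerset.2 (h.subset hB)

/-- The sum of the products `∏_{B ∈ σ} k(B)` over the non-crossing partitions `σ` of `S` with
blocks in `E`. -/
noncomputable def ncSum (E : Finset ι → Prop) (k : Finset ι → R) (S : Finset ι) : R :=
  ∑ σ ∈ ncPartitions E S, ∏ B ∈ σ, k B

theorem ncSum_empty (E : Finset ι → Prop) (k : Finset ι → R) : ncSum E k ∅ = 1 := by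
  have : ncPartitions E (∅ : Finset ι) = {∅} := by
    ext σ
    rw [mem_ncPartitions, Finset.mem_singleton]
    constructor
    · intro h
      refine Finset.eq_empty_of_forall_notMem fun B hB => ?_
      obtain ⟨i, hi⟩ := h.nonempty B hB
      exact absurd (h.subset hB hi) (Finset.notMem_empty i)
    · rintro rfl
      constructor <;> simp
  simp [ncSum, this]

theorem ncSum_congr {E E' : Finset ι → Prop} (k : Finset ι → R) {S : Finset ι}
    (h : ∀ B ⊆ S, E B ↔ E' B) : ncSum E k S = ncSum E' k S := by
  have : ncPartitions E S = ncPartitions E' S := by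
    ext σ
    rw [mem_ncPartitions, mem_ncPartitions]
    exact ⟨fun H => ⟨H.1, fun B hB => (h B (H.subset hB)).1 (H.2 B hB), H.3, H.4, H.5⟩,
      fun H => ⟨H.1, fun B hB => (h B (H.subset hB)).2 (H.2 B hB), H.3, H.4, H.5⟩⟩
  rw [ncSum, this, ncSum]

/-- Multiplicativity of `ncSum` when every admissible block lies in one of two pieces. -/
theorem ncSum_union {E : Finset ι → Prop} (k : Finset ι → R) {S X Y : Finset ι}
    (hS : S = X ∪ Y) (hXY : Disjoint X Y)
    (hE : ∀ B, B ⊆ S → E B → B ⊆ X ∨ B ⊆ Y)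
    (hc : ∀ B C, E B → E C → B ⊆ X → C ⊆ Y → ¬Crosses B C ∧ ¬Crosses C B) :
    ncSum E k S = ncSum E k X * ncSum E k Y := by
  classical
  have hd : ∀ i, i ∈ X → i ∈ Y → False := fun i h1 h2 =>
    Finset.disjoint_left.1 hXY h1 h2
  unfold ncSum
  rw [Finset.sum_mul_sum, ← Finset.sum_product']
  symm
  refine Finset.sum_bij' (fun q _ => q.1 ∪ q.2)
    (fun σ _ => (σ.filter (· ⊆ X), σ.filter (· ⊆ Y))) ?_ ?_ ?_ ?_ ?_
  · rintro ⟨σ, τ⟩ h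
    rw [Finset.mem_product, mem_ncPartitions, mem_ncPartitions] at h
    obtain ⟨h1, h2⟩ := h
    dsimp only at h1 h2
    rw [mem_ncPartitions]
    refine ⟨?_, ?_, ?_, ?_, ?_⟩
    · intro B hB
      exact (Finset.mem_union.1 hB).elim (h1.nonempty B) (h2.nonempty B)
    · intro B hB
      exact (Finset.mem_union.1 hB).elim (h1.block B) (h2.block B)
    · intro B hB C hC i hiB hiC
      rcases Finset.mem_union.1 hB with hB | hB <;> rcases Finset.mem_union.1 hC with hC | hC
      · exact h1.disj B hB C hC i hiB hiC
      · exact (hd i (h1.subset hB hiB) (h2.subset hC hiC)).elim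
      · exact (hd i (h1.subset hC hiC) (h2.subset hB hiB)).elim
      · exact h2.disj B hB C hC i hiB hiC
    · intro i
      rw [hS, Finset.mem_union, h1.mem_iff, h2.mem_iff]
      simp only [Finset.mem_union, or_and_right, exists_or]
    · intro B hB C hC hBC
      rcases Finset.mem_union.1 hB with hB | hB <;> rcases Finset.mem_union.1 hC with hC | hC
      · exact h1.nc B hB C hC hBC
      · exact ((hc B C (h1.block B hB) (h2.block C hC) (h1.subset hB) (h2.subset hC)).1 hBC).elim
      · exact ((hc C B (h1.block C hC) (h2.block B hB) (h1.subset hC) (h2.subset hB)).2 hBC).elim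
      · exact h2.nc B hB C hC hBC
  · intro σ h
    rw [mem_ncPartitions] at h
    have key : ∀ (W : Finset ι), W ⊆ S → (∀ B ∈ σ, ∀ i ∈ B, i ∈ W → B ⊆ W) →
        IsNCPartition E W (σ.filter (· ⊆ W)) := by
      intro W hWS hW
      refine ⟨fun B hB => h.nonempty B (Finset.mem_filter.1 hB).1,
        fun B hB => h.block B (Finset.mem_filter.1 hB).1,
        fun B hB C hC => h.disj B (Finset.mem_filter.1 hB).1 C (Finset.mem_filter.1 hC).1, ?_,
        fun B hB C hC => h.nc B (Finset.mem_filter.1 hB).1 C (Finset.mem_filter.1 hC).1⟩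
      intro i
      constructor
      · intro hi
        obtain ⟨B, hB, hiB⟩ := (h.mem_iff i).1 (hWS hi)
        exact ⟨B, Finset.mem_filter.2 ⟨hB, hW B hB i hiB hi⟩, hiB⟩
      · rintro ⟨B, hB, hiB⟩
        exact (Finset.mem_filter.1 hB).2 hiB
    rw [Finset.mem_product, mem_ncPartitions, mem_ncPartitions]
    refine ⟨key X (hS ▸ Finset.subset_union_left) ?_, key Y (hS ▸ Finset.subset_union_right) ?_⟩
    · intro B hB i hiB hiX
      exact (hE B (h.subset hB) (h.block B hB)).elim id fun H => (hd i hiX (H hiB)).elim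
    · intro B hB i hiB hiX
      exact (hE B (h.subset hB) (h.block B hB)).elim (fun H => (hd i (H hiB) hiX).elim) id
  · rintro ⟨σ, τ⟩ h
    rw [Finset.mem_product, mem_ncPartitions, mem_ncPartitions] at h
    obtain ⟨h1, h2⟩ := h
    dsimp only at h1 h2
    refine Prod.ext ?_ ?_
    · ext B
      simp only [Finset.mem_filter, Finset.mem_union]
      refine ⟨?_, fun hB => ⟨Or.inl hB, h1.subset hB⟩⟩
      rintro ⟨hB | hB, hBX⟩
      · exact hB
      · obtain ⟨i, hi⟩ := h2.nonempty B hB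
        exact (hd i (hBX hi) (h2.subset hB hi)).elim
    · ext B
      simp only [Finset.mem_filter, Finset.mem_union]
      refine ⟨?_, fun hB => ⟨Or.inr hB, h2.subset hB⟩⟩
      rintro ⟨hB | hB, hBX⟩
      · obtain ⟨i, hi⟩ := h1.nonempty B hB
        exact (hd i (h1.subset hB hi) (hBX hi)).elim
      · exact hB
  · intro σ h
    rw [mem_ncPartitions] at h
    ext B
    simp only [Finset.mem_filter, Finset.mem_union]
    refine ⟨fun H => H.elim And.left And.left, fun hB => ?_⟩
    exact (hE B (h.subset hB) (h.block B hB)).imp (⟨hB, ·⟩) (⟨hB, ·⟩)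
  · rintro ⟨σ, τ⟩ h
    rw [Finset.mem_product, mem_ncPartitions, mem_ncPartitions] at h
    obtain ⟨h1, h2⟩ := h
    dsimp only at h1 h2
    refine (Finset.prod_union (Finset.disjoint_left.2 fun B hB hB' => ?_)).symm
    obtain ⟨i, hi⟩ := h1.nonempty B hB
    exact hd i (h1.subset hB hi) (h2.subset hB' hi)

/-- For a non-crossing family `ρ` of disjoint sets, the sums over the non-crossing partitions of its
members multiply to the sum over the non-crossing refinements of `ρ`. -/
theorem prod_ncSum (k : Finset ι → R) (ρ : Finset (Finset ι))
    (hd : ∀ B ∈ ρ, ∀ C ∈ ρ, ∀ i, i ∈ B → i ∈ C → B = C)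
    (hc : ∀ B ∈ ρ, ∀ C ∈ ρ, Crosses B C → B = C) :
    ∏ W ∈ ρ, ncSum (fun _ => True) k W = ncSum (fun B => ∃ W ∈ ρ, B ⊆ W) k (ρ.biUnion id) := by
  classical
  -- The induction runs over subfamilies `ρ'`, but blocks are compared with all of `ρ`, so that the
  -- admissibility condition stays fixed.
  have H : ∀ ρ' ⊆ ρ, ∏ W ∈ ρ', ncSum (fun _ => True) k W =
      ncSum (fun B => ∃ W ∈ ρ, B ⊆ W) k (ρ'.biUnion id) := by
    intro ρ'
    induction ρ' using Finset.induction_on with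
    | empty => intro _; simp [ncSum_empty]
    | insert W ρ' hW ih =>
      intro hsub
      have hWρ := hsub (Finset.mem_insert_self W ρ')
      have hsub' : ρ' ⊆ ρ := fun B hB => hsub (Finset.mem_insert_of_mem hB)
      rw [Finset.prod_insert hW, ih hsub', Finset.biUnion_insert, id]
      rw [ncSum_congr (E' := fun B => ∃ W ∈ ρ, B ⊆ W) k
        (fun B hB => ⟨fun _ => ⟨W, hWρ, hB⟩, fun _ => trivial⟩)]
      have hdis : ∀ i ∈ W, ∀ C ∈ ρ', i ∉ C := fun i hi C hC hiC =>
        hW (hd W hWρ C (hsub' hC) i hi hiC ▸ hC)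
      symm
      refine ncSum_union k rfl ?_ ?_ ?_
      · refine Finset.disjoint_left.2 fun i hi hi' => ?_
        obtain ⟨C, hC, hiC⟩ := Finset.mem_biUnion.1 hi'
        exact hdis i hi C hC hiC
      · rintro B hB ⟨V, hV, hBV⟩
        by_cases hVW : V = W
        · exact Or.inl (hVW ▸ hBV)
        · right
          intro i hi
          rcases Finset.mem_union.1 (hB hi) with h | h
          · exact absurd (hd V hV W hWρ i (hBV hi) h) hVW
          · exact h
      · rintro B C ⟨V, hV, hBV⟩ ⟨V', hV', hCV⟩ hBW hCY
        by_cases hCe : C.Nonempty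
        swap
        · rw [Finset.not_nonempty_iff_eq_empty] at hCe
          subst hCe
          constructor <;> rintro ⟨i, j, k, l, -, -, -, h1, h2, h3, h4⟩ <;> simp_all
        obtain ⟨i, hi⟩ := hCe
        have hne : W ≠ V' := by
          rintro rfl
          obtain ⟨U, hU, hiU⟩ := Finset.mem_biUnion.1 (hCY hi)
          exact hdis i (hCV hi) U hU hiU
        constructor
        · rintro ⟨a, b, c, d, h1, h2, h3, ha, hc', hb, hd'⟩
          exact hne (hc W hWρ V' hV' ⟨a, b, c, d, h1, h2, h3, hBW ha, hBW hc', hCV hb, hCV hd'⟩)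
        · rintro ⟨a, b, c, d, h1, h2, h3, ha, hc', hb, hd'⟩
          exact hne (hc V' hV' W hWρ ⟨a, b, c, d, h1, h2, h3, hCV ha, hCV hc', hBW hb, hBW hd'⟩).symm
  exact H ρ subset_rfl

/-- No element of `V` lies strictly between two elements of `B`. -/
def Unseparated (V B : Finset ι) : Prop := ∀ v ∈ V, ∀ a ∈ B, ∀ b ∈ B, ¬(a < v ∧ v < b)

/-- Sorting the non-crossing partitions of `S ∪ {s}` by the block of the largest element `s`. -/
theorem ncSum_insert_max (k : Finset ι → R) {S : Finset ι} {s : ι} (hs : ∀ i ∈ S, i < s) :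
    ncSum (fun _ => True) k (insert s S) =
      ∑ V ∈ S.powerset, k (insert s V) * ncSum (Unseparated V) k (S \ V) := by
  classical
  have hsS : s ∉ S := fun h => lt_irrefl _ (hs s h)
  simp only [ncSum, Finset.mul_sum]
  rw [Finset.sum_sigma']
  symm
  have nm : ∀ (V : Finset ι) (σ : Finset (Finset ι)), IsNCPartition (Unseparated V) (S \ V) σ →
      insert s V ∉ σ := fun V σ h hm =>
    hsS (Finset.mem_sdiff.1 (h.subset hm (Finset.mem_insert_self s V))).1
  refine Finset.sum_bij (fun q _ => insert (insert s q.1) q.2) ?_ ?_ ?_ ?_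
  · rintro ⟨V, σ⟩ h
    rw [Finset.mem_sigma, Finset.mem_powerset, mem_ncPartitions] at h
    obtain ⟨hV, h⟩ := h
    dsimp only at hV h
    rw [mem_ncPartitions]
    have hdisj : ∀ C ∈ σ, ∀ i, i ∈ insert s V → i ∉ C := by
      intro C hC i hi hiC
      have := Finset.mem_sdiff.1 (h.subset hC hiC)
      rcases Finset.mem_insert.1 hi with rfl | hi
      · exact hsS this.1
      · exact this.2 hi
    have hlt : ∀ C ∈ σ, ∀ i ∈ C, i < s := fun C hC i hi =>
      hs i (Finset.mem_sdiff.1 (h.subset hC hi)).1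
    refine ⟨?_, fun _ _ => trivial, ?_, ?_, ?_⟩
    · intro B hB
      rcases Finset.mem_insert.1 hB with rfl | hB
      · exact Finset.insert_nonempty _ _
      · exact h.nonempty B hB
    · intro B hB C hC i hiB hiC
      rcases Finset.mem_insert.1 hB with rfl | hB <;> rcases Finset.mem_insert.1 hC with rfl | hC
      · rfl
      · exact (hdisj C hC i hiB hiC).elim
      · exact (hdisj B hB i hiC hiB).elim
      · exact h.disj B hB C hC i hiB hiC
    · intro i
      simp only [Finset.mem_insert, exists_eq_or_imp]
      rw [← h.mem_iff, Finset.mem_sdiff]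
      have := @hV i
      tauto
    · rintro B hB C hC ⟨a, b, c, d, h1, h2, h3, ha, hc, hb, hd⟩
      rcases Finset.mem_insert.1 hB with e | hBσ <;> rcases Finset.mem_insert.1 hC with e' | hCσ
      · exact e.trans e'.symm
      · exfalso
        rw [e] at hc
        rcases Finset.mem_insert.1 hc with rfl | hc
        · exact lt_asymm h3 (hlt C hCσ d hd)
        · exact h.block C hCσ c hc b hb d hd ⟨h2, h3⟩
      · exfalso
        rw [e'] at hb
        rcases Finset.mem_insert.1 hb with rfl | hb
        · exact lt_asymm h2 (hlt B hBσ c hc)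
        · exact h.block B hBσ b hb a ha c hc ⟨h1, h2⟩
      · exact h.nc B hBσ C hCσ ⟨a, b, c, d, h1, h2, h3, ha, hc, hb, hd⟩
  · rintro ⟨V, σ⟩ h ⟨V', σ'⟩ h' heq
    rw [Finset.mem_sigma, Finset.mem_powerset, mem_ncPartitions] at h h'
    obtain ⟨hV, h⟩ := h
    obtain ⟨hV', h'⟩ := h'
    dsimp only at hV h hV' h' heq
    have e1 : insert s V = insert s V' := by
      have : insert s V ∈ insert (insert s V') σ' := heq ▸ Finset.mem_insert_self _ _
      rcases Finset.mem_insert.1 this with e | e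
      · exact e
      · exact (hsS (Finset.mem_sdiff.1 (h'.subset e (Finset.mem_insert_self s V))).1).elim
    have e2 : V = V' := by
      rw [← Finset.erase_insert (fun H => hsS (hV H)), e1,
        Finset.erase_insert (fun H => hsS (hV' H))]
    subst e2
    have e3 : σ = σ' := by
      rw [← Finset.erase_insert (nm V σ h), heq, Finset.erase_insert (nm V σ' h')]
    rw [e3]
  · intro π h
    rw [mem_ncPartitions] at h
    obtain ⟨B, hB, hsB⟩ := (h.mem_iff s).1 (Finset.mem_insert_self s S)
    have hBS : B.erase s ⊆ S := by
      intro i hi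
      rw [Finset.mem_erase] at hi
      exact (Finset.mem_insert.1 (h.subset hB hi.2)).resolve_left hi.1
    refine ⟨⟨B.erase s, π.erase B⟩, ?_, ?_⟩
    · rw [Finset.mem_sigma, Finset.mem_powerset, mem_ncPartitions]
      refine ⟨hBS, ?_, ?_, ?_, ?_, ?_⟩
      · exact fun C hC => h.nonempty C (Finset.mem_of_mem_erase hC)
      · rintro C hC v hv a ha b hb ⟨h1, h2⟩
        rw [Finset.mem_erase] at hC hv
        have hbs : b ≠ s := fun e => hC.1 (h.disj C hC.2 B hB s (e ▸ hb) hsB)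
        have hb' : b < s := hs b ((Finset.mem_insert.1 (h.subset hC.2 hb)).resolve_left hbs)
        -- As `s` is the largest element, a block separated by some `v ∈ B` crosses `B` through `a <
        -- v < b < s`.
        exact hC.1 (h.nc C hC.2 B hB ⟨a, v, b, s, h1, h2, hb', ha, hb, hv.2, hsB⟩)
      · exact fun C hC D hD =>
          h.disj C (Finset.mem_of_mem_erase hC) D (Finset.mem_of_mem_erase hD)
      · intro i
        dsimp only
        rw [Finset.mem_sdiff, Finset.mem_erase]
        constructor
        · rintro ⟨hi, hi'⟩
          obtain ⟨C, hC, hiC⟩ := (h.mem_iff i).1 (Finset.mem_insert_of_mem hi)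
          refine ⟨C, Finset.mem_erase.2 ⟨?_, hC⟩, hiC⟩
          rintro rfl
          exact hi' ⟨(hs i hi).ne, hiC⟩
        · rintro ⟨C, hC, hiC⟩
          rw [Finset.mem_erase] at hC
          have his : i ≠ s := fun e => hC.1 (h.disj C hC.2 B hB s (e ▸ hiC) hsB)
          exact ⟨(Finset.mem_insert.1 (h.subset hC.2 hiC)).resolve_left his,
            fun H => hC.1 (h.disj C hC.2 B hB i hiC H.2)⟩
      · exact fun C hC D hD =>
          h.nc C (Finset.mem_of_mem_erase hC) D (Finset.mem_of_mem_erase hD)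
    · dsimp only
      rw [Finset.insert_erase hsB, Finset.insert_erase hB]
  · rintro ⟨V, σ⟩ h
    rw [Finset.mem_sigma, Finset.mem_powerset, mem_ncPartitions] at h
    dsimp only
    rw [Finset.prod_insert (nm V σ h.2)]

end NonCrossingSums

end InfFree

namespace InfFree

/-! ### Free cumulants of words by recursion on the block of the last letter. -/

section GapSums

variable {L R : Type*} [CommRing R]

/-- The sum over the ways of extending a block `vs` by letters of the reversed word `w` to its left,
weighted by `k` of the final block and by `m` of the gaps, where `u` is the part of the current gap
already read. -/
def gapSum (m k : List L → R) : List L → List L → List L → R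
  | [], vs, u => k vs * m u
  | x :: w, vs, u => gapSum m k w vs (x :: u) + m u * gapSum m k w (x :: vs) []

/-- `k` is the family of free cumulants of the moments `m`: expansion of `m` over the block
containing the last letter. -/
def IsGapCumulant (m k : List L → R) : Prop :=
  ∀ w x, m (w.reverse ++ [x]) = gapSum m k w [x] []

/-- Only the choice putting every letter into the block evaluates `k` at the full length; its gaps
are empty and contribute `m [] = 1`. So the recursion is triangular and can be solved for `k` length
by length. -/
theorem gapSum_sub (m k k' : List L → R) (hm : m [] = 1) (n : ℕ)
    (h : ∀ l, l.length ≤ n → k l = k' l) (w vs : List L) (hl : w.length + vs.length ≤ n + 1) :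
    gapSum m k w vs [] - gapSum m k' w vs [] = k (w.reverse ++ vs) - k' (w.reverse ++ vs) := by
  have aux : ∀ (w vs u : List L), w.length + vs.length ≤ n →
      gapSum m k w vs u = gapSum m k' w vs u := by
    intro w
    induction w with
    | nil => intro vs u hl; simp only [gapSum]; rw [h vs (by simpa using hl)]
    | cons x w ih =>
      intro vs u hl
      simp only [List.length_cons] at hl
      simp only [gapSum]
      rw [ih vs _ (by omega), ih (x :: vs) _ (by simp only [List.length_cons]; omega)]
  induction w generalizing vs with
  | nil => simp [gapSum, hm]
  | cons x w ih =>
    simp only [List.length_cons] at hl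
    simp only [gapSum, hm]
    rw [aux w vs _ (by omega)]
    have := ih (x :: vs) (by simp only [List.length_cons]; omega)
    simp only [List.reverse_cons, List.append_assoc, List.singleton_append]
    linear_combination this

/-- Every family of moments has free cumulants. -/
theorem exists_isGapCumulant (m : List L → R) (hm : m [] = 1) : ∃ k, IsGapCumulant m k := by
  have step : ∀ n : ℕ, ∀ k : List L → R, ∃ k' : List L → R, (∀ l, l.length ≤ n → k' l = k l) ∧
      ∀ w x, w.length = n → m (w.reverse ++ [x]) = gapSum m k' w [x] [] := by
    classical
    intro n k
    -- The defect of the recursion at `l`; added to `k` in lengths above `n`, it repairs the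
    -- recursion in length `n + 1`.
    let r : List L → R := fun l => match l.reverse with
      | [] => 0
      | x :: w => m l - gapSum m k w [x] []
    refine ⟨fun l => if l.length ≤ n then k l else k l + r l, fun l hl => if_pos hl, ?_⟩
    intro w x hw
    have := gapSum_sub m (fun l => if l.length ≤ n then k l else k l + r l) k hm n
      (fun l hl => if_pos hl) w [x] (by simp [hw])
    rw [if_neg (by simp [hw])] at this
    have hr : r (w.reverse ++ [x]) = m (w.reverse ++ [x]) - gapSum m k w [x] [] := by
      simp [r]
    rw [hr] at this
    linear_combination -this
  choose g hg1 hg2 using step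
  -- Successive corrections; `K n` is final on words of length at most `n`, so the diagonal `K
  -- l.length l` solves every recursion.
  let K : ℕ → List L → R := fun n => Nat.rec (fun _ => 0) (fun n k => g n k) n
  have hK : ∀ n, K (n + 1) = g n (K n) := fun n => rfl
  have hst : ∀ n d l, l.length ≤ n → K (n + d) l = K n l := by
    intro n d l hl
    induction d with
    | zero => rfl
    | succ d ih => rw [← add_assoc, hK, hg1 _ _ _ (by omega), ih]
  have hsame : ∀ n l, l.length ≤ n → K l.length l = K n l := by
    intro n l hl
    obtain ⟨d, rfl⟩ := Nat.exists_eq_add_of_le hl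
    exact (hst l.length d l le_rfl).symm
  refine ⟨fun l => K l.length l, fun w x => ?_⟩
  have h1 := gapSum_sub m (fun l => K l.length l) (K (w.length + 1)) hm (w.length + 1)
    (fun l hl => hsame _ l hl) w [x] (by simp)
  rw [hsame (w.length + 1) (w.reverse ++ [x]) (by simp), sub_self, sub_eq_zero] at h1
  rw [h1, hK]
  exact hg2 _ _ w x rfl

end GapSums

/-! ### From the recursion to the moment-cumulant formula. -/

section GapSumsOnFinsets

variable {ι L R : Type*} [LinearOrder ι] [CommRing R]

/-- The subword of `a` at the positions in `S`. -/
def subword (a : ι → L) (S : Finset ι) : List L := S.sort.map a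

theorem subword_empty (a : ι → L) : subword a ∅ = [] := by simp [subword]

theorem subword_insert_min (a : ι → L) {S : Finset ι} {i : ι} (h : ∀ j ∈ S, i < j) :
    subword a (insert i S) = a i :: subword a S := by
  rw [subword, Finset.sort_insert (fun a b => a ≤ b) (fun j hj => (h j hj).le)
    (fun hi => lt_irrefl _ (h i hi)), List.map_cons, subword]

theorem sort_insert_max {S : Finset ι} {i : ι} (h : ∀ j ∈ S, j < i) :
    (insert i S).sort = S.sort ++ [i] := by
  have hi : i ∉ S := fun hi => lt_irrefl _ (h i hi)
  refine List.Perm.eq_of_pairwise' (r := (· ≤ ·)) (Finset.pairwise_sort _ _) ?_ ?_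
  · rw [List.pairwise_append]
    refine ⟨Finset.pairwise_sort _ _, List.pairwise_singleton _ _, ?_⟩
    intro j hj k hk
    rw [List.mem_singleton.1 hk]
    exact (h j ((Finset.mem_sort _).1 hj)).le
  · rw [List.perm_ext_iff_of_nodup (Finset.sort_nodup _ _)]
    · intro j
      simp [or_comm]
    · rw [List.nodup_append]
      refine ⟨Finset.sort_nodup _ _, List.nodup_singleton _, ?_⟩
      intro j hj k hk
      rw [List.mem_singleton.1 hk]
      exact (h j ((Finset.mem_sort _).1 hj)).ne

theorem subword_insert_max (a : ι → L) {S : Finset ι} {i : ι} (h : ∀ j ∈ S, j < i) :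
    subword a (insert i S) = subword a S ++ [a i] := by
  simp [subword, sort_insert_max h]

/-- Here `V` is the partial block, `U` the open gap and `W` the positions still to be read. The
bound `N` makes this usable within an induction on size, where the formula is known for the gaps
only. -/
theorem gapSum_subword (m k : List L → R) (a : ι → L) (N : ℕ)
    (hN : ∀ U : Finset ι, U.card < N →
      m (subword a U) = ncSum (fun _ => True) (fun V => k (subword a V)) U)
    (W : Finset ι) : ∀ V U : Finset ι, (∀ i ∈ W, ∀ j ∈ V, i < j) → (∀ i ∈ W, ∀ j ∈ U, i < j) →
      W.card + U.card < N →
      gapSum m k (subword a W).reverse (subword a V) (subword a U) =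
        ∑ V' ∈ W.powerset, k (subword a (V' ∪ V)) *
          ncSum (Unseparated V') (fun B => k (subword a B)) ((W \ V') ∪ U) := by
  induction W using Finset.induction_on_max with
  | empty =>
    intro V U _ _ hc
    simp only [subword_empty, List.reverse_nil, gapSum, Finset.powerset_empty,
      Finset.sum_singleton, Finset.empty_union, Finset.sdiff_self]
    rw [hN U (by simpa using hc)]
    congr 1
    exact ncSum_congr _ fun B _ => by simp [Unseparated]
  | insert i W hi ih =>
    intro V U hV hU hc
    have hiW : i ∉ W := fun h => lt_irrefl _ (hi i h)
    have hiU : i ∉ U := fun h => lt_irrefl _ (hU i (Finset.mem_insert_self _ _) i h)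
    rw [Finset.card_insert_of_notMem hiW] at hc
    rw [subword_insert_max a hi, List.reverse_append, List.reverse_singleton,
      List.singleton_append, gapSum, Finset.sum_powerset_insert hiW]
    congr 1
    · rw [← subword_insert_min a (fun j hj => hU i (Finset.mem_insert_self _ _) j hj)]
      rw [ih V (insert i U) (fun j hj => hV j (Finset.mem_insert_of_mem hj)) ?_
        (by rw [Finset.card_insert_of_notMem hiU]; omega)]
      · refine Finset.sum_congr rfl fun V' hV' => ?_
        rw [Finset.mem_powerset] at hV'
        rw [Finset.insert_sdiff_of_notMem _ (fun h => hiW (hV' h)), Finset.insert_union,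
          Finset.union_insert]
      · intro j hj l hl
        rcases Finset.mem_insert.1 hl with rfl | hl
        · exact hi j hj
        · exact hU j (Finset.mem_insert_of_mem hj) l hl
    · rw [← subword_insert_min a (fun j hj => hV i (Finset.mem_insert_self _ _) j hj)]
      rw [← subword_empty a, ih (insert i V) ∅ ?_ (by simp) (by simp; omega),
        hN U (by omega), Finset.mul_sum]
      · refine Finset.sum_congr rfl fun V' hV' => ?_
        rw [Finset.mem_powerset] at hV'
        have hiV' : i ∉ V' := fun h => hiW (hV' h)
        have hltU : ∀ j ∈ U, i < j := fun j hj => hU i (Finset.mem_insert_self _ _) j hj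
        have hsd : insert i W \ insert i V' = W \ V' := by
          ext j
          simp only [Finset.mem_sdiff, Finset.mem_insert]
          constructor
          · rintro ⟨h1 | h1, h2⟩ <;> tauto
          · rintro ⟨h1, h2⟩
            refine ⟨Or.inr h1, ?_⟩
            rintro (rfl | h)
            · exact hiW h1
            · exact h2 h
        have hltW : ∀ j ∈ W \ V', j < i := fun j hj => hi j (Finset.mem_sdiff.1 hj).1
        -- Once `i` joins the block, no other block may reach from `W \ V'` across `i` into `U`, so
        -- the sum factors and the closed gap splits off.
        rw [Finset.union_empty, hsd, ncSum_union (X := W \ V') (Y := U) _ rfl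
          (Finset.disjoint_left.2 fun j hj hj' => lt_asymm (hltW j hj) (hltU j hj')),
          Finset.insert_union, Finset.union_insert]
        · rw [ncSum_congr (E := Unseparated (insert i V')) (E' := Unseparated V') (S := W \ V'),
            ncSum_congr (E := Unseparated (insert i V')) (E' := fun _ => True) (S := U)]
          · ring
          · refine fun B hB => ⟨fun _ => trivial, fun _ v hv x hx y hy h => ?_⟩
            have h1 := hltU x (hB hx)
            rcases Finset.mem_insert.1 hv with rfl | hv
            · exact lt_asymm h1 h.1
            · exact lt_asymm (h1.trans h.1) (hi v (hV' hv))
          · refine fun B hB => ⟨fun H v hv => H v (Finset.mem_insert_of_mem hv),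
              fun H v hv x hx y hy h => ?_⟩
            rcases Finset.mem_insert.1 hv with rfl | hv
            · exact lt_asymm h.2 (hltW y (hB hy))
            · exact H v hv x hx y hy h
        · intro B hB hBE
          by_contra hcon
          rw [not_or, Finset.not_subset, Finset.not_subset] at hcon
          obtain ⟨⟨x, hx, hx'⟩, ⟨y, hy, hy'⟩⟩ := hcon
          exact hBE i (Finset.mem_insert_self _ _) y hy x hx
            ⟨hltW y ((Finset.mem_union.1 (hB hy)).resolve_right hy'),
              hltU x ((Finset.mem_union.1 (hB hx)).resolve_left hx')⟩
        · intro B C _ _ hB hC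
          constructor
          · rintro ⟨x, y, z, t, h1, h2, h3, hx, hz, hy, ht⟩
            exact lt_asymm h2 ((hltW z (hB hz)).trans (hltU y (hC hy)))
          · rintro ⟨x, y, z, t, h1, h2, h3, hx, hz, hy, ht⟩
            exact lt_asymm h1 ((hltW y (hB hy)).trans (hltU x (hC hx)))
      · intro j hj l hl
        rcases Finset.mem_insert.1 hl with rfl | hl
        · exact hi j hj
        · exact hV j (Finset.mem_insert_of_mem hj) l hl

/-- The free moment-cumulant formula. -/
theorem IsGapCumulant.moment_eq_ncSum {m k : List L → R} (hm : m [] = 1) (hk : IsGapCumulant m k)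
    (a : ι → L) (S : Finset ι) :
    m (subword a S) = ncSum (fun _ => True) (fun V => k (subword a V)) S := by
  induction hn : S.card using Nat.strong_induction_on generalizing S with
  | _ n ih =>
    subst hn
    rcases S.eq_empty_or_nonempty with rfl | hne
    · rw [subword_empty, ncSum_empty, hm]
    · obtain ⟨s, T, hT, rfl⟩ : ∃ s T, (∀ j ∈ T, j < s) ∧ S = insert s T := by
        refine ⟨S.max' hne, S.erase (S.max' hne), fun j hj => S.lt_max'_of_mem_erase_max' hne hj,
          (Finset.insert_erase (S.max'_mem hne)).symm⟩
      have hsT : s ∉ T := fun h => lt_irrefl _ (hT s h)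
      rw [ncSum_insert_max _ hT, subword_insert_max a hT]
      have h1 := hk (subword a T).reverse (a s)
      rw [List.reverse_reverse] at h1
      have h2 := gapSum_subword m k a (insert s T).card (fun U hU => ih _ hU U rfl) T {s} ∅
        (by simpa using hT) (by simp) (by simp [hsT])
      have h3 : subword a {s} = [a s] := by simp [subword]
      rw [h3, subword_empty] at h2
      rw [h1, h2]
      refine Finset.sum_congr rfl fun V _ => ?_
      rw [Finset.union_empty, Finset.union_comm, Finset.insert_eq]

end GapSumsOnFinsets

/-! ### Möbius inversion on the non-crossing partitions. -/

section Moebius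

variable {R : Type*} [CommRing R]

theorem NC.isNCPartition {n : ℕ} (π : NC n) :
    IsNCPartition (fun _ => True) Finset.univ π.1.parts := by
  refine ⟨fun B hB => π.1.nonempty_of_mem_parts hB, fun _ _ => trivial, ?_, ?_, ?_⟩
  · intro B hB C hC i hiB hiC
    exact π.1.disjoint.elim_finset hB hC i hiB hiC
  · intro i
    refine ⟨fun _ => ?_, fun _ => Finset.mem_univ i⟩
    obtain ⟨B, hB, hi⟩ := π.1.exists_mem (Finset.mem_univ i)
    exact ⟨B, hB, hi⟩
  · rintro B hB C hC ⟨i, j, k, l, h1, h2, h3, hi, hk, hj, hl⟩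
    exact π.2 B hB C hC i j k l h1 h2 h3 hi hk hj hl

theorem exists_NC_of_isNCPartition {n : ℕ} {E : Finset (Fin n) → Prop}
    {σ : Finset (Finset (Fin n))} (h : IsNCPartition E Finset.univ σ) :
    ∃ π : NC n, π.1.parts = σ := by
  refine ⟨⟨⟨σ, ?_, ?_, ?_⟩, ?_⟩, rfl⟩
  · rw [Finset.supIndep_iff_pairwiseDisjoint]
    intro B hB C hC hne
    exact Finset.disjoint_left.2 fun i hi hi' => hne (h.disj B hB C hC i hi hi')
  · refine Finset.eq_univ_iff_forall.2 fun i => ?_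
    obtain ⟨B, hB, hi⟩ := (h.mem_iff i).1 (Finset.mem_univ i)
    exact Finset.mem_sup.2 ⟨B, hB, hi⟩
  · intro hbot
    exact (h.nonempty _ hbot).ne_empty rfl
  · intro B hB C hC i j k l h1 h2 h3 hi hk hj hl
    exact h.nc B hB C hC ⟨i, j, k, l, h1, h2, h3, hi, hk, hj, hl⟩

open Classical in
/-- Products of the sums over non-crossing partitions of the blocks of `ρ`, as a sum over
the lower set of `ρ` in `NC(n)`. -/
theorem NC.sum_le_eq_prod {n : ℕ} (k : Finset (Fin n) → R) (ρ : NC n) :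
    ∑ σ : NC n, (if σ ≤ ρ then ∏ V ∈ σ.1.parts, k V else 0) =
      ∏ W ∈ ρ.1.parts, ncSum (fun _ => True) k W := by
  have h := ρ.isNCPartition
  rw [prod_ncSum k ρ.1.parts h.disj h.nc]
  have hU : ρ.1.parts.biUnion id = Finset.univ :=
    Finset.eq_univ_iff_forall.2 fun i => by
      obtain ⟨B, hB, hi⟩ := (h.mem_iff i).1 (Finset.mem_univ i)
      exact Finset.mem_biUnion.2 ⟨B, hB, hi⟩
  rw [hU, ← Finset.sum_filter, ncSum]
  refine Finset.sum_bij (fun σ _ => σ.1.parts) ?_ ?_ ?_ ?_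
  · intro σ hσ
    rw [Finset.mem_filter] at hσ
    have h' := σ.isNCPartition
    rw [mem_ncPartitions]
    refine ⟨h'.1, fun B hB => ?_, h'.3, h'.4, h'.5⟩
    obtain ⟨C, hC, hBC⟩ := hσ.2 hB
    exact ⟨C, hC, hBC⟩
  · intro σ _ τ _ e
    exact Subtype.ext (Finpartition.ext e)
  · intro σ hσ
    rw [mem_ncPartitions] at hσ
    obtain ⟨π, rfl⟩ := exists_NC_of_isNCPartition hσ
    refine ⟨π, Finset.mem_filter.2 ⟨Finset.mem_univ _, fun B hB => ?_⟩, rfl⟩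
    obtain ⟨C, hC, hBC⟩ := hσ.block B hB
    exact ⟨C, hC, hBC⟩
  · intro σ _
    rfl

theorem NC.le_one {n : ℕ} (π : NC n) : π ≤ NC.one n := by
  show π.1 ≤ ⊤
  exact le_top

theorem NC.one_parts {n : ℕ} (hn : 1 ≤ n) : (NC.one n).1.parts = {Finset.univ} := by
  have : NeZero n := ⟨by omega⟩
  have hne : (Finset.univ : Finset (Fin n)) ≠ ⊥ := by
    rw [Finset.bot_eq_empty]; exact Finset.univ_nonempty.ne_empty
  have h := (NC.one n).isNCPartition
  obtain ⟨B, hB, -⟩ := (h.mem_iff 0).1 (Finset.mem_univ 0)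
  have hsub := Finpartition.parts_top_subset (Finset.univ : Finset (Fin n))
  have hB' : B = Finset.univ := Finset.mem_singleton.1 (hsub hB)
  exact Finset.Subset.antisymm hsub (Finset.singleton_subset_iff.2 (hB' ▸ hB))

/-- Möbius inversion of the free moment-cumulant formula. -/
theorem NC.sum_moeb {n : ℕ} (hn : 1 ≤ n) (k : Finset (Fin n) → R) :
    ∑ π : NC n, (π.moeb : R) * ∏ W ∈ π.1.parts, ncSum (fun _ => True) k W = k Finset.univ := by
  classical
  simp only [← NC.sum_le_eq_prod, Finset.mul_sum]
  rw [Finset.sum_comm]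
  have key : ∀ σ : NC n, ∑ π : NC n, (π.moeb : R) * (if σ ≤ π then ∏ V ∈ σ.1.parts, k V else 0) =
      if σ = NC.one n then k Finset.univ else 0 := by
    intro σ
    have h1 : (∑ π : NC n, if σ ≤ π then π.moeb else 0) = if σ = NC.one n then 1 else 0 := by
      rw [← Finset.sum_filter, ← IncidenceAlgebra.sum_Icc_mu_left (𝕜 := ℤ) σ (NC.one n)]
      refine Finset.sum_congr ?_ fun π _ => ?_
      · ext π
        simp [Finset.mem_Icc, NC.le_one]
      · unfold NC.moeb
        congr
    have h2 : ∑ π : NC n, (π.moeb : R) * (if σ ≤ π then ∏ V ∈ σ.1.parts, k V else 0) =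
        ((∑ π : NC n, if σ ≤ π then π.moeb else 0 : ℤ) : R) * ∏ V ∈ σ.1.parts, k V := by
      rw [Int.cast_sum, Finset.sum_mul]
      refine Finset.sum_congr rfl fun π _ => ?_
      split_ifs <;> simp
    rw [h2, h1]
    split_ifs with h
    · subst h
      rw [NC.one_parts hn]
      simp
    · simp
  rw [Finset.sum_congr rfl fun σ _ => key σ]
  simp

variable {A : Type*} [Ring A] [Algebra ℂ A] [Algebra ℂ R]

/-- The Möbius-function definition of the cumulants agrees with the recursive one. -/
theorem cumulant_eq_of_isGapCumulant {L : Type*} (f : A →ₗ[ℂ] R) (hf : f 1 = 1) (e : L → A)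
    {k : List L → R} (hk : IsGapCumulant (fun l => f (l.map e).prod) k) {n : ℕ} (hn : 1 ≤ n)
    (a : Fin n → L) : cumulant f n (fun i => e (a i)) = k (List.ofFn a) := by
  have hm : (fun l : List L => f (l.map e).prod) [] = 1 := by simp [hf]
  have huniv : subword a Finset.univ = List.ofFn a := by
    simp [subword, Fin.sort_univ, List.ofFn_eq_map]
  rw [← huniv, ← NC.sum_moeb hn (fun V => k (subword a V)), cumulant]
  refine Finset.sum_congr rfl fun π _ => ?_
  congr 1
  refine Finset.prod_congr rfl fun V _ => ?_
  rw [← hk.moment_eq_ncSum hm, moment, subword, List.map_map]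
  congr 2
  rw [← Finset.listMap_orderEmbOfFin_finRange V rfl, List.map_map, List.ofFn_eq_map]
  rfl

end Moebius

end InfFree

namespace InfFree

/-! ### Normal forms of products from two subalgebras. -/

section Freeness

variable {R B : Type*} [CommRing R] [Ring B] [Algebra R B]

/-- Products `t₁ s₁ t₂ s₂ ⋯ tₙ` of centred elements, alternately from `T` and from `S`, beginning and
ending in `T`. -/
inductive Alternating (F : B →ₗ[R] R) (S T : Subalgebra R B) : B → Prop
  | single {c : B} : c ∈ T → F c = 0 → Alternating F S T c
  | snoc {n y c : B} : Alternating F S T n → y ∈ S → F y = 0 → c ∈ T → F c = 0 →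
      Alternating F S T (n * y * c)

/-- `F` vanishes on all products of alternating centred elements, with at least one factor in `T`,
up to arbitrary outer factors in `S`. -/
def VanishesOnAlternating (F : B →ₗ[R] R) (S T : Subalgebra R B) : Prop :=
  ∀ n, Alternating F S T n → ∀ y ∈ S, ∀ y' ∈ S, F (y * n * y') = 0

/-- The elements `y n y'` with `n` alternating and `y, y' ∈ S`. -/
def sandwiches (F : B →ₗ[R] R) (S T : Subalgebra R B) : Set B :=
  {z | ∃ n y y', Alternating F S T n ∧ y ∈ S ∧ y' ∈ S ∧ z = y * n * y'}

/-- The span of `S` and the elements `y n y'` with `n` alternating and `y, y' ∈ S`. -/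
def alternatingSpan (F : B →ₗ[R] R) (S T : Subalgebra R B) : Submodule R B :=
  Subalgebra.toSubmodule S ⊔ Submodule.span R (sandwiches F S T)

variable {F : B →ₗ[R] R} {S T : Subalgebra R B}

theorem map_sub_smul_one (hF : F 1 = 1) (b : B) : F (b - F b • 1) = 0 := by
  simp [hF]

theorem sub_smul_one_mem {U : Subalgebra R B} {b : B} (hb : b ∈ U) (r : R) : b - r • 1 ∈ U :=
  U.sub_mem hb (U.smul_mem U.one_mem r)

theorem mem_alternatingSpan_of_mem {b : B} (hb : b ∈ S) : b ∈ alternatingSpan F S T :=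
  Submodule.mem_sup_left hb

theorem Alternating.mem_span {n : B} (hn : Alternating F S T n) {y y' : B} (hy : y ∈ S)
    (hy' : y' ∈ S) : y * n * y' ∈ alternatingSpan F S T :=
  Submodule.mem_sup_right (Submodule.subset_span ⟨n, y, y', hn, hy, hy', rfl⟩)

theorem Alternating.mem_span_left {n : B} (hn : Alternating F S T n) {y : B} (hy : y ∈ S) :
    y * n ∈ alternatingSpan F S T := by
  simpa using hn.mem_span hy S.one_mem

/-- Centring both `y'` and `t` in `y n y' t` leaves either admissible elements or `y n t`, where `t`
is absorbed into the last factor of `n`. -/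
theorem mul_mem_alternatingSpan_of_mem_right (hF : F 1 = 1) {t : B} (ht : t ∈ T) {z : B}
    (hz : z ∈ alternatingSpan F S T) : z * t ∈ alternatingSpan F S T := by
  have hs : ∀ y ∈ S, ∀ c ∈ T, y * c ∈ alternatingSpan F S T := by
    intro y hy c hc
    have h1 : Alternating F S T (c - F c • 1) :=
      .single (sub_smul_one_mem hc _) (map_sub_smul_one hF c)
    have h2 : y * c = y * (c - F c • 1) + F c • y := by
      simp [mul_sub]
    rw [h2]
    exact Submodule.add_mem _ (h1.mem_span_left hy)
      (Submodule.smul_mem _ _ (mem_alternatingSpan_of_mem hy))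
  suffices alternatingSpan F S T ≤ (alternatingSpan F S T).comap (LinearMap.mulRight R t) from
    this hz
  refine sup_le (fun y hy => hs y hy t ht) (Submodule.span_le.2 ?_)
  rintro _ ⟨n, y, y', hn, hy, hy', rfl⟩
  show y * n * y' * t ∈ alternatingSpan F S T
  have h1 : Alternating F S T (n * (y' - F y' • 1) * (t - F t • 1)) :=
    hn.snoc (sub_smul_one_mem hy' _) (map_sub_smul_one hF y') (sub_smul_one_mem ht _)
      (map_sub_smul_one hF t)
  have h2 : y * n * y' * t = y * (n * (y' - F y' • 1) * (t - F t • 1)) +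
      F t • (y * n * (y' - F y' • 1)) + F y' • (y * (n * t)) := by
    simp only [mul_sub, sub_mul, mul_smul_comm, smul_mul_assoc, mul_one, mul_assoc]
    module
  rw [h2]
  refine Submodule.add_mem _ (Submodule.add_mem _ (h1.mem_span_left hy)
    (Submodule.smul_mem _ _ (hn.mem_span hy (sub_smul_one_mem hy' _)))) (Submodule.smul_mem _ _ ?_)
  -- The product of the last factor with `t` is centred again; its scalar part leaves a shorter
  -- alternating product followed by `y₁ ∈ S`, or nothing but `y` when there was one factor.
  cases hn with
  | single hc _ => exact hs y hy _ (T.mul_mem hc ht)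
  | @snoc n y₁ c hn hy₁ hy₁F hc _ =>
    have h3 : Alternating F S T (n * y₁ * (c * t - F (c * t) • 1)) :=
      hn.snoc hy₁ hy₁F (sub_smul_one_mem (T.mul_mem hc ht) _) (map_sub_smul_one hF _)
    have h4 : y * (n * y₁ * c * t) = y * (n * y₁ * (c * t - F (c * t) • 1)) +
        F (c * t) • (y * n * y₁) := by
      simp only [mul_sub, mul_smul_comm, mul_one, mul_assoc]
      module
    rw [h4]
    exact Submodule.add_mem _ (h3.mem_span_left hy) (Submodule.smul_mem _ _ (hn.mem_span hy hy₁))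

theorem mul_mem_alternatingSpan_of_mem_left {s : B} (hs : s ∈ S) {z : B}
    (hz : z ∈ alternatingSpan F S T) : z * s ∈ alternatingSpan F S T := by
  suffices alternatingSpan F S T ≤ (alternatingSpan F S T).comap (LinearMap.mulRight R s) from
    this hz
  refine sup_le (fun y hy => mem_alternatingSpan_of_mem (S.mul_mem hy hs)) (Submodule.span_le.2 ?_)
  rintro _ ⟨n, y, y', hn, hy, hy', rfl⟩
  show y * n * y' * s ∈ alternatingSpan F S T
  rw [mul_assoc]
  exact hn.mem_span hy (S.mul_mem hy' hs)

theorem prod_mem_alternatingSpan (hF : F 1 = 1) (l : List B) (hl : ∀ b ∈ l, b ∈ S ∨ b ∈ T) :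
    l.prod ∈ alternatingSpan F S T := by
  induction l using List.reverseRecOn with
  | nil => exact mem_alternatingSpan_of_mem S.one_mem
  | append_singleton l b ih =>
    rw [List.prod_append, List.prod_singleton]
    have h := ih fun c hc => hl c (by simp [hc])
    rcases hl b (by simp) with hb | hb
    · exact mul_mem_alternatingSpan_of_mem_left hb h
    · exact mul_mem_alternatingSpan_of_mem_right hF hb h

/-- A substitute for traciality, which is not assumed: multiplication by `p` on either side of a
sandwich stays inside its outer factors, so both values vanish. -/
theorem VanishesOnAlternating.map_mul_comm (H : VanishesOnAlternating F S T) {p : B} (hp : p ∈ S)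
    (hcomm : ∀ s ∈ S, p * s = s * p) {z : B} (hz : z ∈ alternatingSpan F S T) :
    F (p * z) = F (z * p) := by
  suffices alternatingSpan F S T ≤
      LinearMap.eqLocus (F ∘ₗ LinearMap.mulLeft R p) (F ∘ₗ LinearMap.mulRight R p) from this hz
  refine sup_le (fun s hs => ?_) (Submodule.span_le.2 ?_)
  · exact congrArg F (hcomm s hs)
  · rintro _ ⟨n, y, y', hn, hy, hy', rfl⟩
    show F (p * (y * n * y')) = F (y * n * y' * p)
    rw [← mul_assoc, ← mul_assoc, H n hn _ (S.mul_mem hp hy) _ hy', mul_assoc,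
      H n hn _ hy _ (S.mul_mem hy' hp)]

end Freeness

/-! ### A Fock-type model and free compression. -/

section FockModel

variable {L R B : Type*} [CommRing R] [Ring B] [Algebra R B]

/-- The operator of a letter `x` on the formal sums of pairs of a word `vs` (a partial block) and
`u : B` (a partial gap): it extends the gap to `e x * u` or closes the gap and extends the block. -/
noncomputable def letterOp (F : B →ₗ[R] R) (e : L → B) (x : L) : Module.End R (List L →₀ B) :=
  Finsupp.lsum R fun vs => Finsupp.lsingle vs ∘ₗ LinearMap.mulLeft R (e x) +
    (LinearMap.toSpanSingleton R _ (Finsupp.single (x :: vs) 1)) ∘ₗ F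

theorem letterOp_single (F : B →ₗ[R] R) (e : L → B) (x : L) (vs : List L) (u : B) :
    letterOp F e x (Finsupp.single vs u) =
      Finsupp.single vs (e x * u) + F u • Finsupp.single (x :: vs) 1 := by
  simp [letterOp]

variable (L R) in
/-- Left multiplication by `b` on the gaps. -/
noncomputable def gapOp (b : B) : Module.End R (List L →₀ B) :=
  Finsupp.mapRange.linearMap (LinearMap.mulLeft R b)

theorem gapOp_single (b : B) (vs : List L) (u : B) :
    gapOp L R b (Finsupp.single vs u) = Finsupp.single vs (b * u) := by
  simp [gapOp]

/-- The functional `vs ⊗ u ↦ k(vs) F(u)`. -/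
noncomputable def readout (F : B →ₗ[R] R) (k : List L → R) : (List L →₀ B) →ₗ[R] R :=
  Finsupp.lsum R fun vs => k vs • F

theorem readout_single (F : B →ₗ[R] R) (k : List L → R) (vs : List L) (u : B) :
    readout F k (Finsupp.single vs u) = k vs * F u := by
  simp [readout]

variable {F : B →ₗ[R] R} {e : L → B} {k : List L → R} {p : B}

theorem readout_word (w vs u : List L) :
    readout F k ((w.reverse.map (letterOp F e)).prod (Finsupp.single vs (u.map e).prod)) =
      gapSum (fun l => F (l.map e).prod) k w vs u := by
  induction w generalizing vs u with
  | nil => simp [readout_single, gapSum]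
  | cons x w ih =>
    rw [List.reverse_cons, List.map_append, List.prod_append, List.map_singleton,
      List.prod_singleton, Module.End.mul_apply, letterOp_single, map_add, map_add, map_smul,
      map_smul, gapSum, ← ih, ← ih]
    simp

/-- The images of the letters and of `p` acting on the model, paired with their values. -/
noncomputable def pairedAlg (F : B →ₗ[R] R) (e : L → B) :
    Subalgebra R (B × Module.End R (List L →₀ B)) :=
  Algebra.adjoin R (Set.range fun x => (e x, letterOp F e x))

/-- The algebra generated by `p`, paired with its action on the model. -/
noncomputable def pairedIdem (R L : Type*) [CommRing R] [Algebra R B] (p : B) :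
    Subalgebra R (B × Module.End R (List L →₀ B)) :=
  Algebra.adjoin R {(p, gapOp L R p)}

theorem fst_mem_of_mem_pairedAlg {y : B × Module.End R (List L →₀ B)} (hy : y ∈ pairedAlg F e) :
    y.1 ∈ Algebra.adjoin R (Set.range e) := by
  have : pairedAlg F e ≤ (Algebra.adjoin R (Set.range e)).comap (AlgHom.fst R B _) := by
    refine Algebra.adjoin_le ?_
    rintro _ ⟨x, rfl⟩
    exact Algebra.subset_adjoin ⟨x, rfl⟩
  exact this hy

theorem fst_mem_of_mem_pairedIdem {y : B × Module.End R (List L →₀ B)}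
    (hy : y ∈ pairedIdem R L p) : y.1 ∈ Algebra.adjoin R {p} := by
  have : pairedIdem R L p ≤ (Algebra.adjoin R {p}).comap (AlgHom.fst R B _) := by
    refine Algebra.adjoin_le ?_
    rintro _ rfl
    exact Algebra.subset_adjoin rfl
  exact this hy

theorem pairedIdem_apply {t : B × Module.End R (List L →₀ B)} (ht : t ∈ pairedIdem R L p)
    (vs : List L) (u : B) : t.2 (Finsupp.single vs u) = Finsupp.single vs (t.1 * u) := by
  induction ht using Algebra.adjoin_induction generalizing u with
  | mem x hx => rw [Set.mem_singleton_iff.1 hx]; exact gapOp_single p vs u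
  | algebraMap r =>
    simp [Prod.algebraMap_apply, Module.algebraMap_end_apply, Algebra.smul_def]
  | add x y _ _ hx hy => simp [hx, hy, add_mul]
  | mul x y _ _ hx hy => rw [Prod.snd_mul, Module.End.mul_apply, hy, hx, Prod.fst_mul, mul_assoc]

/-- Under `hu` the gap always has value zero when a letter tries to close it, so only the
multiplication terms of the letters survive. -/
theorem pairedAlg_apply {y : B × Module.End R (List L →₀ B)} (hy : y ∈ pairedAlg F e)
    (vs : List L) (u : B) (hu : ∀ s ∈ Algebra.adjoin R (Set.range e), F (s * u) = 0) :
    y.2 (Finsupp.single vs u) = Finsupp.single vs (y.1 * u) := by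
  induction hy using Algebra.adjoin_induction generalizing u with
  | mem x hx =>
    obtain ⟨x, rfl⟩ := hx
    have h : F u = 0 := by simpa using hu 1 (one_mem _)
    simp [letterOp_single, h]
  | algebraMap r =>
    simp [Prod.algebraMap_apply, Module.algebraMap_end_apply, Algebra.smul_def]
  | add x y _ _ hx hy => simp [hx u hu, hy u hu, add_mul]
  | mul x y _ hy' hx hy =>
    have h1 := hx (y.1 * u) fun s hs => by
      rw [← mul_assoc]
      exact hu _ (mul_mem hs (fst_mem_of_mem_pairedAlg hy'))
    rw [Prod.snd_mul, Module.End.mul_apply, hy u hu, h1, Prod.fst_mul, mul_assoc]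

theorem Alternating.fst {n : B × Module.End R (List L →₀ B)}
    (hn : Alternating (F ∘ₗ LinearMap.fst R B _) (pairedAlg F e) (pairedIdem R L p) n) :
    Alternating F (Algebra.adjoin R (Set.range e)) (Algebra.adjoin R {p}) n.1 := by
  induction hn with
  | single hc hF => exact .single (fst_mem_of_mem_pairedIdem hc) hF
  | snoc _ hy hyF hc hcF ih =>
    exact ih.snoc (fst_mem_of_mem_pairedAlg hy) hyF (fst_mem_of_mem_pairedIdem hc) hcF

/-- Every gap met while `n` acts is a tail of `n` times `u`, hence an alternating product times `u`,
up to a left factor from the letters. By `hu` it never closes. -/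
theorem alternating_apply {n : B × Module.End R (List L →₀ B)}
    (hn : Alternating (F ∘ₗ LinearMap.fst R B _) (pairedAlg F e) (pairedIdem R L p) n)
    (vs : List L) (u : B)
    (hu : ∀ n', Alternating F (Algebra.adjoin R (Set.range e)) (Algebra.adjoin R {p}) n' →
      ∀ s ∈ Algebra.adjoin R (Set.range e), F (s * n' * u) = 0) :
    n.2 (Finsupp.single vs u) = Finsupp.single vs (n.1 * u) := by
  induction hn generalizing u with
  | single hc _ => exact pairedIdem_apply hc vs u
  | @snoc n y c hn hy hyF hc hcF ih =>
    have h1 := pairedAlg_apply hy vs (c.1 * u) fun s hs => by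
      rw [← mul_assoc]
      exact hu _ (.single (fst_mem_of_mem_pairedIdem hc) hcF) s hs
    have h2 := ih (y.1 * (c.1 * u)) fun n' hn' s hs => by
      have := hu _ (hn'.snoc (fst_mem_of_mem_pairedAlg hy) hyF (fst_mem_of_mem_pairedIdem hc) hcF)
        s hs
      simpa only [mul_assoc] using this
    simp only [Prod.snd_mul, Prod.fst_mul, Module.End.mul_apply]
    rw [pairedIdem_apply hc, h1, h2]
    simp only [mul_assoc]

theorem pairedAlg_apply_single_one_mem {y : B × Module.End R (List L →₀ B)}
    (hy : y ∈ pairedAlg F e) {ξ : List L →₀ B}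
    (hξ : ξ ∈ Submodule.span R {ξ | ∃ vs, ∃ s ∈ Algebra.adjoin R (Set.range e),
      ξ = Finsupp.single vs s}) :
    y.2 ξ ∈ Submodule.span R {ξ | ∃ vs : List L, ∃ s ∈ Algebra.adjoin R (Set.range e),
      ξ = Finsupp.single vs s} := by
  induction hy using Algebra.adjoin_induction generalizing ξ with
  | mem x hx =>
    obtain ⟨x, rfl⟩ := hx
    refine Submodule.span_induction (fun ξ h => ?_) ?_ (fun ξ η _ _ h1 h2 => ?_)
      (fun r ξ _ h => ?_) hξ
    · obtain ⟨vs, s, hs, rfl⟩ := h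
      dsimp only
      rw [letterOp_single]
      exact Submodule.add_mem _
        (Submodule.subset_span ⟨vs, _, mul_mem (Algebra.subset_adjoin ⟨x, rfl⟩) hs, rfl⟩)
        (Submodule.smul_mem _ _ (Submodule.subset_span ⟨_, _, one_mem _, rfl⟩))
    · rw [map_zero]; exact Submodule.zero_mem _
    · rw [map_add]; exact Submodule.add_mem _ h1 h2
    · rw [map_smul]; exact Submodule.smul_mem _ _ h
  | algebraMap r =>
    rw [Prod.algebraMap_apply]
    exact Submodule.smul_mem _ _ hξ
  | add x y _ _ hx hy => exact Submodule.add_mem _ (hx hξ) (hy hξ)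
  | mul x y _ _ hx hy => exact hx (hy hξ)

/-- Words in the letters only. -/
theorem map_mul_eq_readout_of_mem_pairedAlg (hk : IsGapCumulant (fun l => F (l.map e).prod) k)
    {y : B × Module.End R (List L →₀ B)} (hy : y ∈ pairedAlg F e) (x : L) :
    F (y.1 * e x) = readout F k (y.2 (Finsupp.single [x] 1)) := by
  have hy' : y ∈ Subalgebra.toSubmodule (pairedAlg F e) := hy
  rw [pairedAlg, Algebra.adjoin_eq_span] at hy'
  refine Submodule.span_induction (fun y h => ?_) ?_ (fun y z _ _ h1 h2 => ?_)
    (fun r y _ h => ?_) hy'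
  · obtain ⟨l, hl, rfl⟩ := Submonoid.exists_list_of_mem_closure h
    obtain ⟨w, rfl⟩ : ∃ w : List L, w.map (fun x => (e x, letterOp F e x)) = l := by
      have : l ∈ Set.range (List.map fun x => (e x, letterOp F e x)) := by
        rw [Set.range_list_map]
        exact hl
      exact this
    have h1 : ((w.map fun x => (e x, letterOp F e x)).prod).1 = (w.map e).prod := by
      rw [← MonoidHom.coe_fst, map_list_prod, List.map_map]
      rfl
    have h2 : ((w.map fun x => (e x, letterOp F e x)).prod).2 = (w.map (letterOp F e)).prod := by
      rw [← MonoidHom.coe_snd, map_list_prod, List.map_map]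
      rfl
    have h3 := hk w.reverse x
    rw [← readout_word] at h3
    rw [h1, h2]
    simpa using h3
  · simp
  · simp [add_mul, h1, h2]
  · simp [h]

/-- Both sides are zero. On the model, `y'` produces gaps in the letter algebra; then `n` and `y`
merely multiply these, so the readout is a combination of values `F (y n s)`. -/
theorem map_sandwich_mul_eq_readout
    (H : VanishesOnAlternating F (Algebra.adjoin R (Set.range e)) (Algebra.adjoin R {p}))
    {z : B × Module.End R (List L →₀ B)}
    (hz : z ∈ sandwiches (F ∘ₗ LinearMap.fst R B _) (pairedAlg F e) (pairedIdem R L p)) (x : L) :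
    F (z.1 * e x) = readout F k (z.2 (Finsupp.single [x] 1)) := by
  obtain ⟨n, y, y', hn, hy, hy', rfl⟩ := hz
  simp only [Prod.fst_mul, Prod.snd_mul, Module.End.mul_apply]
  have hex : e x ∈ Algebra.adjoin R (Set.range e) := Algebra.subset_adjoin ⟨x, rfl⟩
  rw [mul_assoc, H n.1 hn.fst _ (fst_mem_of_mem_pairedAlg hy) _
    (mul_mem (fst_mem_of_mem_pairedAlg hy') hex)]
  have h1 := pairedAlg_apply_single_one_mem hy' (ξ := Finsupp.single [x] 1)
    (Submodule.subset_span ⟨_, _, one_mem _, rfl⟩)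
  symm
  refine Submodule.span_induction
    (p := fun ξ _ => readout F k (y.2 (n.2 ξ)) = 0) (fun ξ h => ?_) ?_ (fun ξ η _ _ h1 h2 => ?_)
    (fun r ξ _ h => ?_) h1
  · obtain ⟨vs, s, hs, rfl⟩ := h
    rw [alternating_apply hn vs s fun n' hn' s' hs' => H n' hn' s' hs' s hs,
      pairedAlg_apply hy vs _ fun s' hs' => by rw [← mul_assoc]; exact H _ hn.fst s' hs' s hs,
      readout_single, ← mul_assoc, H _ hn.fst _ (fst_mem_of_mem_pairedAlg hy) s hs, mul_zero]
  · simp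
  · simp [h1, h2]
  · simp [h]

/-- The model computes the functional of words in the letters and `p`. -/
theorem map_mul_eq_readout (hF : F 1 = 1) (hk : IsGapCumulant (fun l => F (l.map e).prod) k)
    (H : VanishesOnAlternating F (Algebra.adjoin R (Set.range e)) (Algebra.adjoin R {p}))
    (l : List (B × Module.End R (List L →₀ B)))
    (hl : ∀ c ∈ l, (∃ x, c = (e x, letterOp F e x)) ∨ c = (p, gapOp L R p)) (x : L) :
    F (l.prod.1 * e x) = readout F k (l.prod.2 (Finsupp.single [x] 1)) := by
  have hmem : l.prod ∈ alternatingSpan (F ∘ₗ LinearMap.fst R B _) (pairedAlg F e)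
      (pairedIdem R L p) := by
    refine prod_mem_alternatingSpan (by simpa using hF) l fun c hc => ?_
    rcases hl c hc with ⟨x, rfl⟩ | rfl
    · exact Or.inl (Algebra.subset_adjoin ⟨x, rfl⟩)
    · exact Or.inr (Algebra.subset_adjoin rfl)
  obtain ⟨y, hy, z, hz, hyz⟩ := Submodule.mem_sup.1 hmem
  have hz' : F (z.1 * e x) = readout F k (z.2 (Finsupp.single [x] 1)) := by
    refine Submodule.span_induction (fun z h => ?_) ?_ (fun z z' _ _ h1 h2 => ?_)
      (fun r z _ h => ?_) hz
    · exact map_sandwich_mul_eq_readout H h x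
    · simp
    · simp [add_mul, h1, h2]
    · simp [h]
  rw [← hyz, Prod.fst_add, Prod.snd_add, add_mul, map_add, hz',
    map_mul_eq_readout_of_mem_pairedAlg hk hy x, LinearMap.add_apply, map_add]

/-- The word `p x₁ p x₂ p ⋯ xₙ p`. -/
def compressedWord (p : B) (e : L → B) (l : List L) : B := p * (l.map fun x => e x * p).prod

theorem compressedWord_cons (x : L) (l : List L) :
    compressedWord p e (x :: l) = p * (e x * compressedWord p e l) := by
  simp [compressedWord, mul_assoc]

/-- A closing gap contributes `F p * m u`, and the next gap starts as `p`, the empty compressed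
word. The factors `F p` from the closings complete `F p ^ (vs.length - 1)` to the power for the
final block; the last gap gives the factor on the right. -/
theorem readout_compressedWord {m : List L → R} (hm : ∀ l, F p * m l = F (compressedWord p e l))
    (w vs u : List L) (hvs : vs ≠ []) :
    F p ^ (vs.length - 1) * readout F k
        ((w.reverse.map fun x => gapOp L R p * letterOp F e x).prod
          (Finsupp.single vs (compressedWord p e u))) =
      F p * gapSum m (fun l => F p ^ (l.length - 1) * k l) w vs u := by
  induction w generalizing vs u with
  | nil =>
    simp only [List.reverse_nil, List.map_nil, List.prod_nil, Module.End.one_apply, readout_single,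
      gapSum, ← hm]
    ring
  | cons x w ih =>
    -- Nonemptiness matters for the truncated exponent: it must grow by one when `x` joins the
    -- block.
    obtain ⟨v, vs, rfl⟩ := List.exists_cons_of_ne_nil hvs
    have h1 : (gapOp L R p * letterOp F e x) (Finsupp.single (v :: vs) (compressedWord p e u)) =
        Finsupp.single (v :: vs) (compressedWord p e (x :: u)) +
          (F p * m u) • Finsupp.single (x :: v :: vs) (compressedWord p e []) := by
      rw [Module.End.mul_apply, letterOp_single, map_add, map_smul, gapOp_single, gapOp_single,
        compressedWord_cons, hm]
      simp [compressedWord]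
    rw [List.reverse_cons, List.map_append, List.prod_append, List.map_singleton,
      List.prod_singleton, Module.End.mul_apply, h1, map_add, map_add, map_smul, map_smul, gapSum,
      mul_add, mul_add, ih (v :: vs) _ (by simp)]
    have h2 := ih (x :: v :: vs) [] (by simp)
    simp only [List.length_cons, Nat.add_sub_cancel, smul_eq_mul] at h2 ⊢
    rw [pow_succ] at h2
    linear_combination m u * h2

/-- Free compression: the free cumulants of the compressed letters. -/
theorem isGapCumulant_compressedWord (hF : F 1 = 1) (hp : p * p = p) (hα : IsUnit (F p))
    (hk : IsGapCumulant (fun l => F (l.map e).prod) k)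
    (H : VanishesOnAlternating F (Algebra.adjoin R (Set.range e)) (Algebra.adjoin R {p}))
    (H' : VanishesOnAlternating F (Algebra.adjoin R {p}) (Algebra.adjoin R (Set.range e)))
    {m : List L → R} (hm : ∀ l, F p * m l = F (compressedWord p e l)) :
    IsGapCumulant m fun l => F p ^ (l.length - 1) * k l := by
  intro w x
  have hpp : ∀ b : B, p * (p * b) = p * b := fun b => by rw [← mul_assoc, hp]
  have hcw : ∀ (l : List L) (y : L), p * (l.map fun x => e x * p).prod * e y * p =
      compressedWord p e (l ++ [y]) := fun l y => by simp [compressedWord, mul_assoc]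
  have hpc : ∀ l : List L, p * compressedWord p e l = compressedWord p e l := fun l => by
    rw [compressedWord, hpp]
  have hcomm : ∀ s ∈ Algebra.adjoin R {p}, p * s = s * p := by
    intro s hs
    have := Algebra.commute_of_mem_adjoin_singleton_of_commute hs (Commute.refl p)
    exact this.eq
  -- The final `p` is moved to the front and absorbed by idempotence, so that the word ends in a
  -- letter, as the model requires.
  have htr : F (compressedWord p e (w.reverse ++ [x])) =
      F (p * (w.reverse.map fun x => e x * p).prod * e x) := by
    rw [← hcw, ← H'.map_mul_comm (Algebra.subset_adjoin rfl) hcomm]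
    · simp only [mul_assoc, hpp]
    · have : p * (w.reverse.map fun x => e x * p).prod * e x =
          ([p] ++ (w.reverse.flatMap fun x => [e x, p]) ++ [e x]).prod := by
        rw [List.prod_append, List.prod_append, List.prod_singleton, List.prod_singleton]
        congr 2
        induction w.reverse with
        | nil => rfl
        | cons y l ih => simp [ih, mul_assoc]
      rw [this]
      refine prod_mem_alternatingSpan hF _ fun b hb => ?_
      simp only [List.mem_append, List.mem_flatMap, List.mem_cons,
        List.not_mem_nil, or_false] at hb
      rcases hb with (rfl | ⟨y, -, rfl | rfl⟩) | rfl
      · exact Or.inl (Algebra.subset_adjoin rfl)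
      · exact Or.inr (Algebra.subset_adjoin ⟨y, rfl⟩)
      · exact Or.inl (Algebra.subset_adjoin rfl)
      · exact Or.inr (Algebra.subset_adjoin ⟨x, rfl⟩)
  have h1 := map_mul_eq_readout hF hk H
    ((w.reverse.flatMap fun x => [(p, gapOp L R p), (e x, letterOp F e x)]) ++ [(p, gapOp L R p)])
    (by
      intro c hc
      simp only [List.mem_append, List.mem_flatMap, List.mem_cons,
        List.not_mem_nil, or_false] at hc
      rcases hc with ⟨y, -, rfl | rfl⟩ | rfl
      · exact Or.inr rfl
      · exact Or.inl ⟨y, rfl⟩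
      · exact Or.inr rfl) x
  have h2 : ((w.reverse.flatMap fun x => [(p, gapOp L R p), (e x, letterOp F e x)]) ++
      [(p, gapOp L R p)]).prod = (p * (w.reverse.map fun x => e x * p).prod,
        (w.reverse.map fun x => gapOp L R p * letterOp F e x).prod * gapOp L R p) := by
    rw [List.prod_append, List.prod_singleton]
    induction w.reverse with
    | nil => simp
    | cons y l ih =>
      rw [List.flatMap_cons, List.prod_append, mul_assoc, ih]
      simp [mul_assoc]
  rw [h2] at h1
  have h3 := readout_compressedWord (k := k) hm w [x] [] (by simp)
  simp only [Module.End.mul_apply, gapOp_single] at h1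
  have h4 : compressedWord p e [] = p := by simp [compressedWord]
  rw [h4] at h3
  rw [mul_one, ← htr, ← hm] at h1
  refine hα.mul_left_cancel ?_
  rw [← h3, h1]
  simp

end FockModel

end InfFree

namespace InfFree

/-! ### Lists alternating between two classes. -/

section AlternatingLists

variable {B : Type*}

/-- The entries of the list satisfy `Q i`, `Q (i + 1)`, `Q i`, … in turn. -/
def AlternatingList (Q : Fin 2 → B → Prop) : Fin 2 → List B → Prop
  | _, [] => True
  | i, c :: l => Q i c ∧ AlternatingList Q (i + 1) l

variable {Q : Fin 2 → B → Prop}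

theorem fin_two_add_one_add_one (i : Fin 2) : i + 1 + 1 = i := by
  revert i; decide

theorem AlternatingList.mono {C : Type*} {Q' : Fin 2 → C → Prop} (f : B → C)
    (h : ∀ i b, Q i b → Q' i (f b)) : ∀ {i : Fin 2} {l : List B}, AlternatingList Q i l →
      AlternatingList Q' i (l.map f)
  | _, [], _ => trivial
  | i, b :: _, H => ⟨h i b H.1, AlternatingList.mono f h H.2⟩

theorem AlternatingList.getElem {i : Fin 2} {l : List B} (h : AlternatingList Q i l) (j : ℕ)
    (hj : j < l.length) : Q (if Even j then i else i + 1) l[j] := by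
  induction l generalizing i j with
  | nil => simp at hj
  | cons b l ih =>
    cases j with
    | zero => simpa using h.1
    | succ j =>
      have := ih h.2 j (by simpa using hj)
      rw [fin_two_add_one_add_one] at this
      simp only [List.getElem_cons_succ, Nat.even_add_one]
      by_cases hj : Even j
      · simpa [hj] using this
      · simpa [hj] using this

theorem AlternatingList.reverse_append {i : Fin 2} {u v : List B} {c : B}
    (hu : AlternatingList Q (i + 1) u) (hc : Q i c) (hv : AlternatingList Q (i + 1) v) :
    ∃ j, AlternatingList Q j (u.reverse ++ c :: v) := by
  induction u generalizing i c v with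
  | nil => exact ⟨i, hc, hv⟩
  | cons d u ih =>
    rw [List.reverse_cons, List.append_assoc]
    exact ih hu.2 hu.1 (by rw [fin_two_add_one_add_one]; exact ⟨hc, hv⟩)

theorem AlternatingList.of_reverse_append {j : Fin 2} {u v : List B} {c : B}
    (h : AlternatingList Q j (u.reverse ++ c :: v)) :
    ∃ i, AlternatingList Q (i + 1) u ∧ Q i c ∧ AlternatingList Q (i + 1) v := by
  induction u generalizing c v with
  | nil => exact ⟨j, trivial, h.1, h.2⟩
  | cons d u ih =>
    rw [List.reverse_cons, List.append_assoc] at h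
    obtain ⟨i, h1, h2, h3⟩ := ih h
    refine ⟨i + 1, ?_, h3.1, h3.2⟩
    rw [fin_two_add_one_add_one]
    exact ⟨h2, h1⟩

end AlternatingLists

/-! ### Infinitesimal freeness of two algebras as a Leibniz rule. -/

section TwoAlgebras

variable {A : Type*} [Ring A] [Algebra ℂ A] {P : Incps A} {S : Fin 2 → Subalgebra ℂ A}

/-- Alternating lists of `φ`-centred elements of `S 0` and `S 1`. -/
abbrev Incps.AltCentred (P : Incps A) (S : Fin 2 → Subalgebra ℂ A) : Fin 2 → List A → Prop :=
  AlternatingList fun i a => a ∈ S i ∧ P.φ a = 0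

/-- With two algebras the palindrome condition on the indices is automatic in odd length, since
opposite positions have equal parity. The default `0` of `getD` is never reached. -/
theorem Incps.FreeSubalgebras.apply_list (h : P.FreeSubalgebras S) {i : Fin 2} {l : List A}
    (hl : P.AltCentred S i l) (hne : l ≠ []) :
    P.φ l.prod = 0 ∧ (Even l.length → P.φ' l.prod = 0) ∧
      ∀ m, l.length = 2 * m + 1 → P.φ' l.prod =
        (∏ j ∈ Finset.range m, P.φ (l.getD j 0 * l.getD (2 * m - j) 0)) * P.φ' (l.getD m 0) := by
  have hpos : 0 < l.length := List.length_pos_iff.2 hne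
  obtain ⟨h1, h2, h3⟩ := h l.length hpos (fun j => if Even (j : ℕ) then i else i + 1) l.get
    (by
      intro j hj
      by_cases hj : Even j
      · simp [hj, Nat.even_add_one]
      · simp [hj, Nat.even_add_one])
    (fun j => (hl.getElem j j.2).1) (fun j => (hl.getElem j j.2).2)
  rw [List.ofFn_get] at h1 h2 h3
  refine ⟨h1, fun he => h3 fun H => Nat.not_odd_iff_even.2 he H.1, fun m hm => ?_⟩
  have hrev : ∀ j : Fin l.length, (if Even (j : ℕ) then i else i + 1) =
      if Even (j.rev : ℕ) then i else i + 1 := by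
    intro j
    have : Even (j : ℕ) ↔ Even (j.rev : ℕ) := by
      rw [Fin.val_rev, show l.length - ((j : ℕ) + 1) = 2 * m - j by omega,
        Nat.even_sub (by omega)]
      simp
    simp only [this]
  rw [h2 ⟨⟨m, hm⟩, hrev⟩]
  have hdiv : l.length / 2 = m := by omega
  congr 1
  · refine Finset.prod_bij (fun j _ => (j : ℕ)) ?_ ?_ ?_ ?_
    · intro j hj
      simpa [hdiv] using hj
    · intro a _ b _ hab
      exact Fin.ext hab
    · intro j hj
      rw [Finset.mem_range] at hj
      exact ⟨⟨j, by omega⟩, by simpa [hdiv] using hj, rfl⟩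
    · intro j hj
      have e : l.length - ((j : ℕ) + 1) = 2 * m - j := by omega
      have hj2 : 2 * m - (j : ℕ) < l.length := by omega
      rw [List.getD_eq_getElem _ _ j.2, List.getD_eq_getElem _ _ hj2]
      simp only [List.get_eq_getElem, Fin.val_rev, e]
  · rw [List.getD_eq_getElem _ _ (by omega)]
    simp only [List.get_eq_getElem, hdiv]

theorem Incps.FreeSubalgebras.φ_reverse_append (h : P.FreeSubalgebras S) {i : Fin 2} {u v : List A}
    {c : A} (hu : P.AltCentred S (i + 1) u) (hc : c ∈ S i) (hc0 : P.φ c = 0)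
    (hv : P.AltCentred S (i + 1) v) : P.φ (u.reverse.prod * (c * v.prod)) = 0 := by
  obtain ⟨j, hj⟩ := AlternatingList.reverse_append hu ⟨hc, hc0⟩ hv
  have := (h.apply_list hj (by simp)).1
  simpa using this

/-- The two innermost factors lie in the same algebra; the centred part of their product is killed
by freeness, and its mean splits off. The pairing continues outwards and fails if one side runs out
first. -/
theorem Incps.FreeSubalgebras.φ_reverse_mul (h : P.FreeSubalgebras S) {i : Fin 2} {u v : List A}
    (hu : P.AltCentred S i u) (hv : P.AltCentred S i v) :
    P.φ (u.reverse.prod * v.prod) = if u.length = v.length then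
      ∏ j ∈ Finset.range u.length, P.φ (u.getD j 0 * v.getD j 0) else 0 := by
  induction u generalizing i v with
  | nil =>
    cases v with
    | nil => simp [P.φ_one]
    | cons d v =>
      have := (h.apply_list hv (by simp)).1
      simpa using this
  | cons c u ih =>
    cases v with
    | nil =>
      have := h.φ_reverse_append hu.2 hu.1.1 hu.1.2 (v := []) trivial
      simpa [mul_assoc] using this
    | cons d v =>
      have e : (c :: u).reverse.prod * (d :: v).prod =
          u.reverse.prod * ((c * d - P.φ (c * d) • 1) * v.prod) +
            P.φ (c * d) • (u.reverse.prod * v.prod) := by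
        simp [sub_mul, mul_sub, mul_assoc]
      rw [e, map_add, map_smul, ih hu.2 hv.2, h.φ_reverse_append hu.2 _ _ hv.2]
      · simp only [List.length_cons, add_left_inj, smul_eq_mul, zero_add]
        split_ifs
        · rw [Finset.prod_range_succ']
          simp [mul_comm]
        · simp
      · exact (S i).sub_mem ((S i).mul_mem hu.1.1 hv.1.1) ((S i).smul_mem (S i).one_mem _)
      · simp [P.φ_one]

/-- The sum `∑ⱼ φ'(lⱼ) φ(u₁ ⋯ uₘ l₁ ⋯ lⱼ₋₁ lⱼ₊₁ ⋯ lₙ)`, where `u` is given in reversed order. -/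
noncomputable def Incps.omitSum (P : Incps A) : List A → List A → ℂ
  | _, [] => 0
  | u, c :: l => P.φ' c * P.φ (u.reverse.prod * l.prod) + P.omitSum (c :: u) l

theorem Incps.FreeSubalgebras.φ_omit (h : P.FreeSubalgebras S) {j : Fin 2} {u v : List A} {c : A}
    (hl : P.AltCentred S j (u.reverse ++ c :: v)) (hne : u.length ≠ v.length) :
    P.φ (u.reverse.prod * v.prod) = 0 := by
  obtain ⟨i, h1, -, h2⟩ := hl.of_reverse_append
  rw [h.φ_reverse_mul h1 h2, if_neg hne]

theorem Incps.FreeSubalgebras.omitSum_even (h : P.FreeSubalgebras S) {j : Fin 2} {u l : List A}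
    (hl : P.AltCentred S j (u.reverse ++ l)) (he : Even (u.length + l.length)) :
    P.omitSum u l = 0 := by
  induction l generalizing u with
  | nil => rfl
  | cons c l ih =>
    simp only [List.length_cons] at he
    rw [omitSum, h.φ_omit hl (fun e => by rw [e, ← add_assoc, Nat.even_add_one] at he; simp at he),
      ih (by simpa using hl) (by simp only [List.length_cons]; rwa [add_right_comm, add_assoc])]
    simp

theorem Incps.FreeSubalgebras.omitSum_le (h : P.FreeSubalgebras S) {j : Fin 2} {u l : List A}
    (hl : P.AltCentred S j (u.reverse ++ l)) (hle : l.length ≤ u.length) :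
    P.omitSum u l = 0 := by
  induction l generalizing u with
  | nil => rfl
  | cons c l ih =>
    simp only [List.length_cons] at hle
    rw [omitSum, h.φ_omit hl (by omega),
      ih (by simpa using hl) (by simp only [List.length_cons]; omega)]
    simp

/-- Omitting a factor makes its neighbours meet in one algebra, and the outward pairing is complete
only if equally many factors lie on both sides. Hence the middle term alone survives. -/
theorem Incps.FreeSubalgebras.omitSum_middle (h : P.FreeSubalgebras S) {j : Fin 2}
    {u l v : List A} {c : A} (hl : P.AltCentred S j (u.reverse ++ (l ++ c :: v)))
    (hlen : u.length + l.length = v.length) :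
    P.omitSum u (l ++ c :: v) = P.φ' c * P.φ (u.reverse.prod * l.prod * v.prod) := by
  induction l generalizing u with
  | nil =>
    rw [List.nil_append, omitSum, h.omitSum_le (by simpa using hl) (by simp at hlen ⊢; omega)]
    simp
  | cons d l ih =>
    simp only [List.length_cons] at hlen
    have h1 : P.φ (u.reverse.prod * (l ++ c :: v).prod) = 0 := h.φ_omit hl (by simp; omega)
    rw [List.cons_append, omitSum, h1,
      ih (by simpa using hl) (by simp only [List.length_cons]; omega)]
    simp [mul_assoc]

/-- The infinitesimal freeness condition as a Leibniz rule. -/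
theorem Incps.FreeSubalgebras.φ'_eq_omitSum (h : P.FreeSubalgebras S) {i : Fin 2} {l : List A}
    (hl : P.AltCentred S i l) (hne : l ≠ []) : P.φ' l.prod = P.omitSum [] l := by
  obtain ⟨-, h2, h3⟩ := h.apply_list hl hne
  rcases Nat.even_or_odd l.length with he | ⟨m, hm⟩
  · rw [h2 he, h.omitSum_even (u := []) hl (by simpa using he)]
  · rw [h3 m hm]
    have hmlt : m < l.length := by omega
    obtain ⟨u, c, v, rfl, hu, hv⟩ : ∃ u c v, l = u ++ c :: v ∧ u.length = m ∧ v.length = m :=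
      ⟨l.take m, l[m], l.drop (m + 1), by simp, by simp; omega, by simp; omega⟩
    rw [h.omitSum_middle (u := []) hl (by simp [hu, hv])]
    have hl' : P.AltCentred S i (u.reverse.reverse ++ c :: v) := by simpa using hl
    obtain ⟨i', h4, -, h5⟩ := hl'.of_reverse_append
    have h6 := h.φ_reverse_mul h4 h5
    rw [List.length_reverse, if_pos (hu.trans hv.symm), List.reverse_reverse] at h6
    rw [List.reverse_nil, List.prod_nil, one_mul, h6, mul_comm, hu]
    congr 1
    · simp [List.getD_eq_getElem?_getD, ← hu]
    -- The pairing proceeds from the middle outwards, the freeness condition from the ends inwards.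
    · rw [← Finset.prod_range_reflect]
      refine Finset.prod_congr rfl fun j hj => ?_
      rw [Finset.mem_range] at hj
      congr 2
      · simp only [List.getD_eq_getElem?_getD]
        rw [List.getElem?_append_left (by omega), List.getElem?_reverse (by omega), hu]
      · simp only [List.getD_eq_getElem?_getD]
        rw [List.getElem?_append_right (by omega), hu,
          show 2 * m - (m - 1 - j) - m = j + 1 by omega, List.getElem?_cons_succ]

end TwoAlgebras

/-! ### Infinitesimal freeness as freeness over `ℂ[ε]`. -/

section DualNumbers

theorem fst_list_prod {A : Type*} [Ring A] (l : List (DualNumber A)) :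
    l.prod.fst = (l.map TrivSqZeroExt.fst).prod := by
  induction l with
  | nil => simp
  | cons b l ih => simp [ih]

variable {A : Type*} [Ring A] [Algebra ℂ A]

/-- The inclusion `ℂ[ε] → A[ε]`. -/
noncomputable def dualIncl (A : Type*) [Ring A] [Algebra ℂ A] (z : DualNumber ℂ) : DualNumber A :=
  (algebraMap ℂ A z.fst, algebraMap ℂ A z.snd)

theorem fst_dualIncl (z : DualNumber ℂ) : (dualIncl A z).fst = algebraMap ℂ A z.fst := rfl

theorem snd_dualIncl (z : DualNumber ℂ) : (dualIncl A z).snd = algebraMap ℂ A z.snd := rfl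

/-- The ring homomorphism `ℂ[ε] → A[ε]`. -/
noncomputable def dualRingHom (A : Type*) [Ring A] [Algebra ℂ A] :
    DualNumber ℂ →+* DualNumber A where
  toFun := dualIncl A
  map_one' := by ext <;> simp [fst_dualIncl, snd_dualIncl]
  map_zero' := by ext <;> simp [fst_dualIncl, snd_dualIncl]
  map_add' _ _ := by
    ext
    · simp [fst_dualIncl]
    · simp only [snd_dualIncl, TrivSqZeroExt.snd_add, map_add]
  map_mul' z w := by
    ext
    · simp [fst_dualIncl]
    · simp only [snd_dualIncl, fst_dualIncl, TrivSqZeroExt.snd_mul, map_add, smul_eq_mul,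
        MulOpposite.smul_eq_mul_unop, MulOpposite.unop_op, map_mul]

theorem fst_dualRingHom (z : DualNumber ℂ) : (dualRingHom A z).fst = algebraMap ℂ A z.fst := rfl

theorem snd_dualRingHom (z : DualNumber ℂ) : (dualRingHom A z).snd = algebraMap ℂ A z.snd := rfl

/-- `A[ε]` as an algebra over `ℂ[ε]`. -/
noncomputable abbrev dualAlgebra (A : Type*) [Ring A] [Algebra ℂ A] :
    Algebra (DualNumber ℂ) (DualNumber A) :=
  (dualRingHom A).toAlgebra' fun z b => by
    ext
    · simp only [TrivSqZeroExt.fst_mul, fst_dualRingHom, Algebra.commutes]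
    · simp only [TrivSqZeroExt.snd_mul, fst_dualRingHom, snd_dualRingHom, smul_eq_mul,
        MulOpposite.smul_eq_mul_unop, MulOpposite.unop_op, Algebra.commutes]
      exact add_comm _ _

attribute [local instance] dualAlgebra

theorem dual_fst_smul (z : DualNumber ℂ) (b : DualNumber A) : (z • b).fst = z.fst • b.fst := by
  rw [Algebra.smul_def z b]
  rw [RingHom.algebraMap_toAlgebra', TrivSqZeroExt.fst_mul, fst_dualRingHom, Algebra.smul_def]

theorem dual_snd_smul (z : DualNumber ℂ) (b : DualNumber A) :
    (z • b).snd = z.fst • b.snd + z.snd • b.fst := by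
  rw [Algebra.smul_def z b]
  rw [RingHom.algebraMap_toAlgebra', TrivSqZeroExt.snd_mul, fst_dualRingHom, snd_dualRingHom,
    smul_eq_mul, MulOpposite.smul_eq_mul_unop, MulOpposite.unop_op, Algebra.smul_def,
    Algebra.smul_def, Algebra.commutes z.snd]

/-- The `ℂ[ε]`-linear extension of `φ̃` to `A[ε]`. -/
noncomputable def Incps.dualFunctional (P : Incps A) : DualNumber A →ₗ[DualNumber ℂ] DualNumber ℂ where
  toFun b := TrivSqZeroExt.inl (P.φ b.fst) + TrivSqZeroExt.inr (P.φ' b.fst + P.φ b.snd)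
  map_add' b c := by
    ext
    · simp
    · simp; ring
  map_smul' z b := by
    ext
    · simp [dual_fst_smul]
    · simp [dual_fst_smul, dual_snd_smul]; ring

theorem Incps.fst_dualFunctional (P : Incps A) (b : DualNumber A) :
    (P.dualFunctional b).fst = P.φ b.fst := by
  simp [dualFunctional]

theorem Incps.snd_dualFunctional (P : Incps A) (b : DualNumber A) :
    (P.dualFunctional b).snd = P.φ' b.fst + P.φ b.snd := by
  simp [dualFunctional]

theorem Incps.dualFunctional_inl (P : Incps A) (a : A) :
    P.dualFunctional (TrivSqZeroExt.inl a) = P.consolidated a := by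
  simp [dualFunctional, consolidated]

theorem Incps.dualFunctional_one (P : Incps A) : P.dualFunctional 1 = 1 := by
  ext
  · simp [fst_dualFunctional, P.φ_one]
  · simp [snd_dualFunctional, P.φ'_one]

theorem mem_of_mem_adjoin_inl {X : Set A} {b : DualNumber A}
    (hb : b ∈ Algebra.adjoin (DualNumber ℂ) (TrivSqZeroExt.inl '' X : Set (DualNumber A))) :
    b.fst ∈ Algebra.adjoin ℂ X ∧ b.snd ∈ Algebra.adjoin ℂ X := by
  induction hb using Algebra.adjoin_induction with
  | mem x hx =>
    obtain ⟨a, ha, rfl⟩ := hx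
    exact ⟨Algebra.subset_adjoin ha, by simp⟩
  | algebraMap r =>
    rw [RingHom.algebraMap_toAlgebra']
    rw [fst_dualRingHom, snd_dualRingHom]
    exact ⟨Subalgebra.algebraMap_mem _ _, Subalgebra.algebraMap_mem _ _⟩
  | add x y _ _ hx hy => exact ⟨add_mem hx.1 hy.1, add_mem hx.2 hy.2⟩
  | mul x y _ _ hx hy =>
    refine ⟨mul_mem hx.1 hy.1, ?_⟩
    rw [TrivSqZeroExt.snd_mul]
    exact add_mem (mul_mem hx.1 hy.2) (mul_mem hx.2 hy.1)

variable {P : Incps A} {X : Fin 2 → Set A}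

/-- The `ℂ[ε]`-subalgebra of `A[ε]` generated by a subset of `A`. -/
noncomputable abbrev dualAdjoin (X : Set A) : Subalgebra (DualNumber ℂ) (DualNumber A) :=
  Algebra.adjoin (DualNumber ℂ) (TrivSqZeroExt.inl '' X)

/-- Alternating lists of centred elements over `ℂ[ε]`. -/
abbrev Incps.DualAltCentred (P : Incps A) (X : Fin 2 → Set A) :
    Fin 2 → List (DualNumber A) → Prop :=
  AlternatingList fun i b => b ∈ dualAdjoin (X i) ∧ P.dualFunctional b = 0

theorem Incps.DualAltCentred.map_fst {i : Fin 2} {l : List (DualNumber A)}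
    (hl : P.DualAltCentred X i l) :
    P.AltCentred (fun i => Algebra.adjoin ℂ (X i)) i (l.map TrivSqZeroExt.fst) := by
  refine AlternatingList.mono _ (fun i b hb => ⟨(mem_of_mem_adjoin_inl hb.1).1, ?_⟩) hl
  rw [← fst_dualFunctional, hb.2]
  rfl

/-- The soul of a product replaces one body at a time by the corresponding soul. By freeness only
the mean of that soul matters, and for a factor `a + εb` with `F`-value zero this mean is `φ(b) =
-φ'(a)`. The prefix `u` collects the bodies already passed. -/
theorem Incps.FreeSets.φ_snd_prod (h : P.FreeSets X) {i : Fin 2} {u : List A}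
    {l : List (DualNumber A)} (hu : P.AltCentred (fun i => Algebra.adjoin ℂ (X i)) (i + 1) u)
    (hl : P.DualAltCentred X i l) :
    P.φ (u.reverse.prod * l.prod.snd) = -P.omitSum u (l.map TrivSqZeroExt.fst) := by
  induction l generalizing i u with
  | nil => simp [omitSum]
  | cons b l ih =>
    have hb := mem_of_mem_adjoin_inl hl.1.1
    have h1 : P.φ b.fst = 0 := by rw [← fst_dualFunctional, hl.1.2]; rfl
    have h2 : P.φ' b.fst + P.φ b.snd = 0 := by rw [← snd_dualFunctional, hl.1.2]; rfl
    have h3 := ih (i := i + 1) (u := b.fst :: u)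
      (by rw [fin_two_add_one_add_one]; exact ⟨⟨hb.1, h1⟩, hu⟩) hl.2
    have h4 : P.φ (u.reverse.prod *
        ((b.snd - P.φ b.snd • 1) * (l.map TrivSqZeroExt.fst).prod)) = 0 :=
      Incps.FreeSubalgebras.φ_reverse_append h (i := i) hu
        (sub_mem hb.2 (Subalgebra.smul_mem _ (one_mem _) _)) (by simp [P.φ_one])
        (Incps.DualAltCentred.map_fst hl.2)
    rw [List.prod_cons, TrivSqZeroExt.snd_mul, List.map_cons, omitSum, fst_list_prod]
    simp only [smul_eq_mul, MulOpposite.smul_eq_mul_unop, MulOpposite.unop_op, mul_add, map_add]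
    rw [List.reverse_cons, List.prod_append, List.prod_singleton, mul_assoc] at h3
    rw [h3]
    simp only [sub_mul, mul_sub, map_sub, smul_mul_assoc, one_mul, mul_smul_comm, map_smul,
      smul_eq_mul] at h4
    linear_combination h4 + P.φ (u.reverse.prod * (l.map TrivSqZeroExt.fst).prod) * h2

/-- Infinitesimal freeness is freeness of the `ℂ[ε]`-linear extension. -/
theorem Incps.FreeSets.dualFunctional_prod (h : P.FreeSets X) {i : Fin 2}
    {l : List (DualNumber A)} (hl : P.DualAltCentred X i l) (hne : l ≠ []) :
    P.dualFunctional l.prod = 0 := by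
  have h1 := hl.map_fst
  have hne' : l.map TrivSqZeroExt.fst ≠ [] := by simpa using hne
  have h2 := h.φ_snd_prod (u := []) trivial hl
  rw [List.reverse_nil, List.prod_nil, one_mul] at h2
  ext
  · rw [fst_dualFunctional, fst_list_prod]
    exact (Incps.FreeSubalgebras.apply_list h h1 hne').1
  · rw [snd_dualFunctional, h2, fst_list_prod, Incps.FreeSubalgebras.φ'_eq_omitSum h h1 hne']
    simp

/-- The last clause records that the list ends in the class `i + 1`, in the form needed to append a
further centred factor. -/
theorem Incps.FreeSets.exists_list_of_alternating {i : Fin 2} {n : DualNumber A}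
    (hn : Alternating P.dualFunctional (dualAdjoin (X i)) (dualAdjoin (X (i + 1))) n) :
    ∃ l ≠ [], n = l.prod ∧
      ∀ l', P.DualAltCentred X i l' → P.DualAltCentred X (i + 1) (l ++ l') := by
  induction hn with
  | @single c hc hc0 =>
    refine ⟨[c], by simp, by simp, fun l' hl' => ⟨⟨hc, hc0⟩, ?_⟩⟩
    rwa [fin_two_add_one_add_one]
  | @snoc n y c _ hy hy0 hc hc0 ih =>
    obtain ⟨l, hl, rfl, H⟩ := ih
    refine ⟨l ++ [y, c], by simp, by simp [mul_assoc], fun l' hl' => ?_⟩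
    rw [List.append_assoc]
    refine H _ ⟨⟨hy, hy0⟩, ⟨hc, hc0⟩, ?_⟩
    rwa [fin_two_add_one_add_one]

/-- Splitting each outer factor into centred part and mean leaves four alternating centred products,
on all of which the functional vanishes. -/
theorem Incps.FreeSets.vanishesOnAlternating (h : P.FreeSets X) (i : Fin 2) :
    VanishesOnAlternating P.dualFunctional (dualAdjoin (X i)) (dualAdjoin (X (i + 1))) := by
  intro n hn y hy y' hy'
  obtain ⟨l, hl, rfl, H⟩ := exists_list_of_alternating hn
  set F := P.dualFunctional with hFdef
  have hF : F 1 = 1 := P.dualFunctional_one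
  have c1 : ∀ {b}, b ∈ dualAdjoin (X i) → b - F b • 1 ∈ dualAdjoin (X i) ∧ F (b - F b • 1) = 0 :=
    fun {b} hb => ⟨sub_smul_one_mem hb _, map_sub_smul_one hF b⟩
  have e0 : F l.prod = 0 := by
    have := H [] trivial
    rw [List.append_nil] at this
    exact h.dualFunctional_prod this hl
  have e1 : F (l.prod * (y' - F y' • 1)) = 0 := by
    have := h.dualFunctional_prod (H [y' - F y' • 1] ⟨c1 hy', trivial⟩) (by simp)
    simpa using this
  have e2 : F ((y - F y • 1) * l.prod) = 0 := by
    have h1 := H [] trivial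
    rw [List.append_nil] at h1
    have := h.dualFunctional_prod (i := i) (l := (y - F y • 1) :: l) ⟨c1 hy, h1⟩ (by simp)
    rwa [List.prod_cons] at this
  have e3 : F ((y - F y • 1) * (l.prod * (y' - F y' • 1))) = 0 := by
    have h1 := H [y' - F y' • 1] ⟨c1 hy', trivial⟩
    have := h.dualFunctional_prod (i := i) (l := (y - F y • 1) :: (l ++ [y' - F y' • 1]))
      ⟨c1 hy, h1⟩ (by simp)
    simpa using this
  simp only [sub_mul, mul_sub, smul_mul_assoc, mul_smul_comm, one_mul, mul_one, map_sub, map_smul,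
    e0, smul_zero, sub_zero] at e1 e2 e3
  rw [e1, e2] at e3
  simpa [mul_assoc] using e3

end DualNumbers

end InfFree

namespace InfFree

/-! ### Body and soul of cumulants, and compression over `ℂ[ε]`. -/

section Consolidation

variable {A : Type*} [Ring A] [Algebra ℂ A] (P : Incps A)

theorem Incps.fst_consolidated (a : A) : (P.consolidated a).fst = P.φ a := by
  simp [consolidated]

theorem Incps.snd_consolidated (a : A) : (P.consolidated a).snd = P.φ' a := by
  simp [consolidated]

theorem Incps.consolidated_one : P.consolidated 1 = 1 := by
  ext
  · simp [fst_consolidated, P.φ_one]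
  · simp [snd_consolidated, P.φ'_one]

theorem fst_finset_prod {ι : Type*} (s : Finset ι) (f : ι → DualNumber ℂ) :
    (∏ i ∈ s, f i).fst = ∏ i ∈ s, (f i).fst :=
  map_prod (TrivSqZeroExt.fstHom ℂ ℂ ℂ) f s

/-- The Leibniz rule, which makes the sum over a distinguished block in `κ'` the soul of the
cumulant of `φ̃`. -/
theorem snd_finset_prod {ι : Type*} [DecidableEq ι] (s : Finset ι) (f : ι → DualNumber ℂ) :
    (∏ i ∈ s, f i).snd = ∑ i ∈ s, (f i).snd * ∏ j ∈ s.erase i, (f j).fst := by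
  induction s using Finset.induction_on with
  | empty => simp
  | insert a s ha ih =>
    rw [Finset.prod_insert ha, Finset.sum_insert ha, Finset.erase_insert ha,
      TrivSqZeroExt.snd_mul, ih, fst_finset_prod]
    simp only [smul_eq_mul, MulOpposite.smul_eq_mul_unop, MulOpposite.unop_op, Finset.mul_sum]
    rw [add_comm]
    congr 1
    refine Finset.sum_congr rfl fun i hi => ?_
    have hia : a ≠ i := fun h => ha (h ▸ hi)
    rw [Finset.erase_insert_of_ne hia, Finset.prod_insert (fun h => ha (Finset.mem_of_mem_erase h))]
    ring

theorem Incps.fst_κtilde (n : ℕ) (a : Fin n → A) : (P.κtilde n a).fst = P.κ n a := by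
  simp only [κtilde, κ, cumulant, TrivSqZeroExt.fst_sum, TrivSqZeroExt.fst_mul,
    TrivSqZeroExt.fst_intCast, fst_finset_prod, moment, fst_consolidated]

theorem Incps.snd_κtilde (n : ℕ) (a : Fin n → A) : (P.κtilde n a).snd = P.κ' n a := by
  classical
  simp only [κtilde, κ', cumulant, TrivSqZeroExt.snd_sum, TrivSqZeroExt.snd_mul,
    TrivSqZeroExt.fst_intCast, TrivSqZeroExt.snd_intCast, snd_finset_prod, moment,
    fst_consolidated, snd_consolidated, smul_zero, add_zero, smul_eq_mul, mul_assoc,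
    Finset.mul_sum]

theorem cumulant_smul {R : Type*} [CommRing R] [Algebra ℂ R] (f : A →ₗ[ℂ] R) (n : ℕ) (c : ℂ)
    (a : Fin n → A) : cumulant f n (fun i => c • a i) = c ^ n • cumulant f n a := by
  have hm : ∀ V : Finset (Fin n), moment f (restr (fun i => c • a i) V) =
      c ^ V.card • moment f (restr a V) := by
    intro V
    have hl : ∀ {m : ℕ} (b : Fin m → A), (List.ofFn fun i => c • b i).prod =
        c ^ m • (List.ofFn b).prod := by
      intro m b
      induction m with
      | zero => simp
      | succ m ih => simp [List.ofFn_succ, ih, pow_succ, smul_smul, mul_comm]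
    rw [moment, moment, ← map_smul, ← hl]
    rfl
  rw [cumulant, cumulant, Finset.smul_sum]
  refine Finset.sum_congr rfl fun π _ => ?_
  rw [Finset.prod_congr rfl fun V _ => hm V, Finset.prod_smul, mul_smul_comm,
    Finset.prod_pow_eq_pow_sum, π.1.sum_card_parts, Finset.card_univ, Fintype.card_fin]

theorem Incps.κ_smul (n : ℕ) (c : ℂ) (a : Fin n → A) :
    P.κ n (fun i => c • a i) = c ^ n * P.κ n a :=
  cumulant_smul P.φ n c a

theorem Incps.κ'_smul (n : ℕ) (c : ℂ) (a : Fin n → A) :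
    P.κ' n (fun i => c • a i) = c ^ n * P.κ' n a := by
  rw [← snd_κtilde, ← snd_κtilde, κtilde, cumulant_smul]
  rfl

variable {p : A} (hp : IsIdempotentElem p) (hα : P.φ p ≠ 0)

/-- This is `ψ̃ = φ̃/α̃` without division: the correction term in `ψ'` is the soul of `1/α̃`
multiplied by `φ`. -/
theorem Incps.mul_consolidated_compression (b : hp.Corner) :
    P.consolidated p * (P.compression hp hα).consolidated b = P.consolidated b.1 := by
  have h : cornerIncl hp b = b.1 := rfl
  ext
  · simp only [TrivSqZeroExt.fst_mul, fst_consolidated, compression, LinearMap.smul_apply,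
      LinearMap.comp_apply, h, smul_eq_mul]
    field_simp
  · simp only [TrivSqZeroExt.snd_mul, fst_consolidated, snd_consolidated, compression,
      LinearMap.smul_apply, LinearMap.sub_apply, LinearMap.comp_apply, h, smul_eq_mul,
      MulOpposite.smul_eq_mul_unop, MulOpposite.unop_op]
    field_simp
    ring

theorem compress_list_prod {L A : Type*} [Ring A] {p : A} (hp : IsIdempotentElem p) (e : L → A) (l : List L) :
    ((l.map fun x => compress hp (e x)).prod).1 = compressedWord p e l := by
  induction l with
  | nil => simp only [compressedWord, List.map_nil, List.prod_nil, mul_one]; rfl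
  | cons x l ih =>
    rw [List.map_cons, List.prod_cons]
    show p * e x * p * ((l.map fun x => compress hp (e x)).prod).1 = _
    rw [ih, compressedWord_cons, compressedWord]
    have : p * (p * (l.map fun x => e x * p).prod) = p * (l.map fun x => e x * p).prod := by
      rw [← mul_assoc, hp.eq]
    simp only [mul_assoc, this]

attribute [local instance] dualAlgebra

theorem inl_list_prod {L A : Type*} [Ring A] (e : L → A) (l : List L) :
    (TrivSqZeroExt.inl (l.map e).prod : DualNumber A) =
      (l.map fun x => TrivSqZeroExt.inl (e x)).prod := by
  induction l with
  | nil => simp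
  | cons x l ih => simp [← ih, TrivSqZeroExt.inl_mul]

theorem inl_compressedWord {L A : Type*} [Ring A] {p : A} (e : L → A) (l : List L) :
    (TrivSqZeroExt.inl (compressedWord p e l) : DualNumber A) =
      compressedWord (TrivSqZeroExt.inl p) (fun x => TrivSqZeroExt.inl (e x)) l := by
  rw [compressedWord, compressedWord, TrivSqZeroExt.inl_mul, inl_list_prod]
  simp only [TrivSqZeroExt.inl_mul]

/-- The `ℂ[ε]`-valued cumulants of a free compression. -/
theorem Incps.κtilde_compression {X : Set A} (hX : P.FreeSets ![X, {p}]) {n : ℕ} (hn : 1 ≤ n)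
    (x : Fin n → A) (hx : ∀ i, x i ∈ X) :
    (P.compression hp hα).κtilde n (fun i => compress hp (x i)) =
      P.consolidated p ^ (n - 1) * P.κtilde n x := by
  have hF := P.dualFunctional_one
  -- The letters are the elements of `X` themselves, so that one family `k` serves for the original
  -- and the compressed words.
  let e : X → DualNumber A := fun x => TrivSqZeroExt.inl x.1
  let q : DualNumber A := TrivSqZeroExt.inl p
  have hq : P.dualFunctional q = P.consolidated p := P.dualFunctional_inl p
  have hrange : Set.range e = TrivSqZeroExt.inl '' X := by
    ext b
    simp [e]
  obtain ⟨k, hk⟩ := exists_isGapCumulant (fun l : List X => P.dualFunctional (l.map e).prod)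
    (by simpa using hF)
  have H : VanishesOnAlternating P.dualFunctional
      (Algebra.adjoin (DualNumber ℂ) (Set.range e)) (Algebra.adjoin (DualNumber ℂ) {q}) := by
    have := hX.vanishesOnAlternating 0
    rw [hrange, ← Set.image_singleton (f := TrivSqZeroExt.inl) (a := p)]
    exact this
  have H' : VanishesOnAlternating P.dualFunctional
      (Algebra.adjoin (DualNumber ℂ) {q}) (Algebra.adjoin (DualNumber ℂ) (Set.range e)) := by
    have := hX.vanishesOnAlternating 1
    rw [hrange, ← Set.image_singleton (f := TrivSqZeroExt.inl) (a := p)]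
    exact this
  have hunit : IsUnit (P.dualFunctional q) := by
    rw [TrivSqZeroExt.isUnit_iff_isUnit_fst, hq, fst_consolidated]
    exact hα.isUnit
  have hk' := isGapCumulant_compressedWord (p := q)
    (m := fun l : List X => (P.compression hp hα).consolidated
      (l.map fun x => compress hp x.1).prod) hF
    (by rw [← TrivSqZeroExt.inl_mul, hp.eq]) hunit hk H H' (fun l => by
      rw [hq, mul_consolidated_compression, compress_list_prod, ← P.dualFunctional_inl,
        inl_compressedWord])
  have hk0 : IsGapCumulant (fun l : List X => P.consolidated (l.map Subtype.val).prod) k := by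
    have : (fun l : List X => P.consolidated (l.map Subtype.val).prod) =
        fun l : List X => P.dualFunctional (l.map e).prod := by
      funext l
      rw [← P.dualFunctional_inl, inl_list_prod]
    rw [this]
    exact hk
  have h1 := cumulant_eq_of_isGapCumulant P.consolidated P.consolidated_one Subtype.val hk0 hn
    fun i => ⟨x i, hx i⟩
  have h2 := cumulant_eq_of_isGapCumulant (P.compression hp hα).consolidated
    (P.compression hp hα).consolidated_one (fun x : X => compress hp x.1) hk' hn
    fun i => ⟨x i, hx i⟩
  rw [List.length_ofFn, hq, ← h1] at h2
  exact h2

end Consolidation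

end InfFree

/-! ### The theorem: extraction of body and soul. -/

open InfFree
theorem theorem5p4 {A : Type*} [Ring A] [Algebra ℂ A] (P : Incps A)
    (p : A) (hp : IsIdempotentElem p) (hα : P.φ p ≠ 0)
    (X : Set A) (hX : P.FreeSets ![X, {p}]) :
    -- body part
    (∀ n : ℕ, 1 ≤ n → ∀ x : Fin n → A, (∀ i, x i ∈ X) →
      (P.compression hp hα).κ n (fun i => compress hp (x i)) =
        1 / P.φ p * P.κ n (fun i => P.φ p • x i)) ∧
    -- soul part, first order
    (∀ x₁ ∈ X, (P.compression hp hα).κ' 1 ![compress hp x₁] = P.κ' 1 ![x₁]) ∧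
    -- soul part, higher orders
    (∀ n : ℕ, 2 ≤ n → ∀ x : Fin n → A, (∀ i, x i ∈ X) →
      (P.compression hp hα).κ' n (fun i => compress hp (x i)) =
        1 / P.φ p * P.κ' n (fun i => P.φ p • x i) +
          ((n : ℂ) - 1) * P.φ' p / P.φ p ^ 2 * P.κ n (fun i => P.φ p • x i)) ∧
    -- the consolidated formula, and its body and soul parts
    (∀ n : ℕ, 1 ≤ n → ∀ x : Fin n → A, (∀ i, x i ∈ X) →
      (P.compression hp hα).κtilde n (fun i => compress hp (x i)) =
        P.consolidated p ^ (n - 1) * P.κtilde n x ∧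
      ((P.compression hp hα).κtilde n (fun i => compress hp (x i))).fst =
        (P.compression hp hα).κ n (fun i => compress hp (x i)) ∧
      ((P.compression hp hα).κtilde n (fun i => compress hp (x i))).snd =
        (P.compression hp hα).κ' n (fun i => compress hp (x i))) := by
  have hmain := fun (n : ℕ) (hn : 1 ≤ n) (x : Fin n → A) (hx : ∀ i, x i ∈ X) =>
    P.κtilde_compression hp hα hX hn x hx
  have hκ : ∀ n : ℕ, 1 ≤ n → ∀ x : Fin n → A, (∀ i, x i ∈ X) →
      (P.compression hp hα).κ n (fun i => compress hp (x i)) = P.φ p ^ (n - 1) * P.κ n x := by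
    intro n hn x hx
    have h := congrArg TrivSqZeroExt.fst (hmain n hn x hx)
    rwa [TrivSqZeroExt.fst_mul, TrivSqZeroExt.fst_pow, Incps.fst_κtilde, Incps.fst_κtilde,
      Incps.fst_consolidated] at h
  -- The soul of `α̃ ^ (n - 1)` is `(n - 1) α ^ (n - 2) α'`. At `n = 1` the exponent is truncated,
  -- but its coefficient is zero, which is why the first-order formula has no correction term.
  have hκ' : ∀ n : ℕ, 1 ≤ n → ∀ x : Fin n → A, (∀ i, x i ∈ X) →
      (P.compression hp hα).κ' n (fun i => compress hp (x i)) =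
        P.φ p ^ (n - 1) * P.κ' n x +
          ((n - 1 : ℕ) : ℂ) * P.φ p ^ (n - 1 - 1) * P.φ' p * P.κ n x := by
    intro n hn x hx
    have h := congrArg TrivSqZeroExt.snd (hmain n hn x hx)
    rw [TrivSqZeroExt.snd_mul, TrivSqZeroExt.snd_pow, TrivSqZeroExt.fst_pow, Incps.fst_κtilde,
      Incps.snd_κtilde, Incps.snd_κtilde, Incps.fst_consolidated, Incps.snd_consolidated] at h
    simp only [smul_eq_mul, MulOpposite.smul_eq_mul_unop, MulOpposite.unop_op, nsmul_eq_mul,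
      Nat.pred_eq_sub_one] at h
    rw [h]
    ring
  refine ⟨fun n hn x hx => ?_, fun x₁ hx₁ => ?_, fun n hn x hx => ?_, fun n hn x hx =>
    ⟨hmain n hn x hx, Incps.fst_κtilde _ _ _, Incps.snd_κtilde _ _ _⟩⟩
  · obtain ⟨m, rfl⟩ := Nat.exists_eq_add_of_le' hn
    rw [hκ _ hn x hx, P.κ_smul, Nat.add_sub_cancel, pow_succ]
    field_simp
  · have h := hκ' 1 le_rfl ![x₁] (by simpa using hx₁)
    have e : (fun i => compress hp ((![x₁] : Fin 1 → A) i)) = ![compress hp x₁] := by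
      funext i
      fin_cases i
      rfl
    rw [e] at h
    simpa using h
  · obtain ⟨m, rfl⟩ := Nat.exists_eq_add_of_le' hn
    rw [hκ' _ (by omega) x hx, P.κ_smul, P.κ'_smul, show m + 2 - 1 = m + 1 by omega,
      Nat.add_sub_cancel]
    push_cast
    field_simp
    ring
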